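/- Let $P$ be a finite set of points in the Euclidean plane. Say that two noncollinear triples $(a,b,c),(a',b',c')\in P^3$ determine the same triangle if some isometry of the plane maps $\{a,b,c\}$ onto $\{a',b',c'\}$. This is an equivalence relation on the noncollinear triples of points of $P$; its equivalence classes are called the distinct triangles determined by $P$. For a positive integer $t$, let $F(t)$ denote the maximum number of points in a finite set $P\subset\mathbb{R}^2$ that determines exactly $t$ distinct triangles. Then: 1. $F(1)=4$ (in particular, this maximum exists), and a set of $4$ points in the plane determines exactly $1$ distinct triangle if and only if it is the set of vertices of a (nondegenerate) rectangle. 2. $F(2)=5$ (in particular, this maximum exists), and a set of $5$ points in the plane determines exactly $2$ distinct triangles if and only if it consists of the four vertices of a square together with the center of the square, or is the set of vertices of a regular pentagon. -/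

import Mathlib

namespace FewTriangles

/-- The Euclidean plane. -/
abbrev Plane : Type := EuclideanSpace ℝ (Fin 2)

/-- The noncollinear triples of points of `P`. -/
abbrev NoncollinearTriple (P : Finset Plane) : Type :=
  {t : Fin 3 → Plane // (∀ i, t i ∈ P) ∧ ¬ Collinear ℝ (Set.range t)}

/-- Two triples determine the same triangle if some isometry of the plane maps the vertices of
the first onto the vertices of the second; the order of the vertices is irrelevant. -/
def sameTriangle (P : Finset Plane) : Setoid (NoncollinearTriple P) where
  r s t := ∃ f : Plane ≃ᵢ Plane, f '' Set.range s.1 = Set.range t.1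
  iseqv :=
    { refl := fun s => ⟨IsometryEquiv.refl Plane, Set.image_id _⟩
      symm := by
        rintro s t ⟨f, hf⟩
        refine ⟨f.symm, ?_⟩
        rw [← hf, ← Set.image_comp]
        simp
      trans := by
        rintro s t u ⟨f, hf⟩ ⟨g, hg⟩
        refine ⟨f.trans g, ?_⟩
        rw [← hg, ← hf, ← Set.image_comp]
        rfl }

/-- The set of distinct triangles determined by `P`. -/
abbrev Triangles (P : Finset Plane) : Type := Quotient (sameTriangle P)

/-- The number of distinct triangles determined by `P`. -/
noncomputable def numTriangles (P : Finset Plane) : ℕ := Nat.card (Triangles P)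

/-- The numbers of points of the finite planar sets that determine exactly `t` distinct
triangles. -/
def sizesDetermining (t : ℕ) : Set ℕ :=
  {n | ∃ P : Finset Plane, P.card = n ∧ numTriangles P = t}

/-- `A`, `B`, `C`, `D` are, in cyclic order, the vertices of a nondegenerate rectangle. -/
def RectangleVertices (A B C D : Plane) : Prop :=
  A ≠ B ∧ A ≠ D ∧ B - A = C - D ∧ inner ℝ (B - A) (D - A) = 0

/-- `A`, `B`, `C`, `D` are, in cyclic order, the vertices of a nondegenerate square. -/
def SquareVertices (A B C D : Plane) : Prop :=
  RectangleVertices A B C D ∧ dist A B = dist A D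

/-- `P` is the set of vertices of a rectangle. -/
def IsRectangle (P : Finset Plane) : Prop :=
  ∃ A B C D : Plane, RectangleVertices A B C D ∧ (P : Set Plane) = {A, B, C, D}

/-- `P` consists of the vertices of a square together with its center. -/
def IsSquareWithCenter (P : Finset Plane) : Prop :=
  ∃ A B C D : Plane, SquareVertices A B C D ∧
    (P : Set Plane) = {A, B, C, D, midpoint ℝ A C}

/-- `P` is the set of vertices of a regular `n`-gon: `n` equally spaced points on a circle with
center `c` and radius `r > 0`, for `n ≥ 3`. -/
def IsRegularPolygon (n : ℕ) (P : Finset Plane) : Prop :=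
  3 ≤ n ∧ ∃ (c : Plane) (r θ : ℝ), 0 < r ∧
    (P : Set Plane) = Set.range fun k : Fin n =>
      c + r • !₂[Real.cos (θ + 2 * Real.pi * (k : ℕ) / n),
        Real.sin (θ + 2 * Real.pi * (k : ℕ) / n)]

end FewTriangles

namespace FewTriangles

/-! A triangle is recorded through two congruence invariants, its doubled area and the sum of its
squared sides; at most two classes leave at most two such pairs (`Types`). Areas add under
subdivision, and with only two values available this forces equalities; when the two values differ,
equal area gives equal side sum (`Types.sideSum_eq`). Suppose b lies between a and c, and d is off
their line. The areas of abd, bcd and their sum acd take at most two values, so b is the midpoint of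
ac and d lies on the perpendicular bisector at a fixed distance. No fourth point fits on the line
and at most two off it, so five points form a square with its center
(`Types.isSquareWithCenter_of_midpoint`). In general position a point inside a triangle would be the
center of an equilateral triangle, which leaves no place for a fifth point
(`Types.noInteriorPoint`). Hence five points form a convex pentagon. Linear and Grassmann-Plücker
relations between its ten areas make all ears equal and all other triangles equal, in golden ratio
(`ConvexPentagon.goldenAreas`). This fixes the pentagon up to an affine map and excludes a sixth
point; equal side sums make it regular. With a single class, collinear triples, interior points and
pentagons are all excluded because each needs two areas; what remains is a parallelogram with equal
diagonals. The classifications hold for all sets of at least 4, respectively 5, points and so also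
bound the size. Conversely, tables of squared distances count the triangles of each configuration.
-/

/-! ### Signed areas, squared distances and congruence of triangles. -/

/-- Twice the signed area of the triangle `a b c`. -/
noncomputable def cr (a b c : Plane) : ℝ :=
  (b 0 - a 0) * (c 1 - a 1) - (b 1 - a 1) * (c 0 - a 0)

/-- The squared distance of two points. -/
noncomputable def sq (a b : Plane) : ℝ := (a 0 - b 0) ^ 2 + (a 1 - b 1) ^ 2

/-- The sum of the squared side lengths of a triangle. -/
noncomputable def sideSum (a b c : Plane) : ℝ := sq a b + sq b c + sq c a

theorem sq_eq_dist_sq (a b : Plane) : sq a b = dist a b ^ 2 := by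
  rw [EuclideanSpace.dist_eq, Real.sq_sqrt (by positivity)]
  simp [sq, Fin.sum_univ_two, Real.dist_eq, sq_abs]

theorem plane_ext {a b : Plane} (h0 : a 0 = b 0) (h1 : a 1 = b 1) : a = b := by
  ext i; fin_cases i <;> assumption

theorem sq_pos {a b : Plane} (h : a ≠ b) : 0 < sq a b := by
  rw [sq_eq_dist_sq]; exact pow_pos (dist_pos.2 h) 2

theorem dist_eq_of_sq_eq {a b c d : Plane} (h : sq a b = sq c d) : dist a b = dist c d := by
  rw [sq_eq_dist_sq, sq_eq_dist_sq] at h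
  exact (pow_left_inj₀ dist_nonneg dist_nonneg two_ne_zero).1 h

theorem collinear_range_iff (t : Fin 3 → Plane) :
    Collinear ℝ (Set.range t) ↔ cr (t 0) (t 1) (t 2) = 0 := by
  have hr : Set.range t = {t 0, t 1, t 2} := by
    ext x; simp [Fin.exists_fin_succ, eq_comm]
  rw [hr]
  constructor
  · intro h
    obtain ⟨v, hv⟩ := (collinear_iff_of_mem (p₀ := t 0) (by simp)).1 h
    obtain ⟨r, hr⟩ := hv (t 1) (by simp)
    obtain ⟨s, hs⟩ := hv (t 2) (by simp)
    rw [hr, hs]; simp [cr]; ring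
  · intro h
    by_cases hne : t 0 = t 1
    · rw [hne]; simpa using collinear_pair ℝ (t 1) (t 2)
    · refine (collinear_iff_of_mem (p₀ := t 0) (by simp)).2 ⟨t 1 - t 0, ?_⟩
      have hp := sq_pos hne
      have hp' := hp.ne'
      simp only [cr, sq] at h hp hp'
      intro p hp3
      rcases hp3 with rfl | rfl | rfl
      · exact ⟨0, by simp⟩
      · exact ⟨1, by simp⟩
      · refine ⟨((t 1 0 - t 0 0) * (t 2 0 - t 0 0) + (t 1 1 - t 0 1) * (t 2 1 - t 0 1)) /
          ((t 0 0 - t 1 0) ^ 2 + (t 0 1 - t 1 1) ^ 2), ?_⟩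
        apply plane_ext
        · simp only [vadd_eq_add, PiLp.add_apply, PiLp.smul_apply, PiLp.sub_apply, smul_eq_mul]
          field_simp
          linear_combination (-(t 1 1 - t 0 1)) * h
        · simp only [vadd_eq_add, PiLp.add_apply, PiLp.smul_apply, PiLp.sub_apply, smul_eq_mul]
          field_simp
          linear_combination (t 1 0 - t 0 0) * h

/-- Two nondegenerate triangles with the same side lengths are related by an isometry. -/
theorem exists_isometryEquiv {a b c a' b' c' : Plane} (h : cr a b c ≠ 0)
    (hab : sq a' b' = sq a b) (hbc : sq b' c' = sq b c) (hca : sq c' a' = sq c a) :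
    ∃ f : Plane ≃ᵢ Plane, f a = a' ∧ f b = b' ∧ f c = c' := by
  -- Cramer's rule expands x in the basis b - a, c - a; `L` keeps the coefficients and moves the
  -- basis to b' - a', c' - a'.
  let L : Plane →ₗ[ℝ] Plane :=
    { toFun := fun x =>
        ((x 0 * (c 1 - a 1) - x 1 * (c 0 - a 0)) / cr a b c) • (b' - a') +
        (((b 0 - a 0) * x 1 - (b 1 - a 1) * x 0) / cr a b c) • (c' - a')
      map_add' := fun x y => by
        apply plane_ext <;> simp <;> ring
      map_smul' := fun r x => by
        apply plane_ext <;> simp <;> ring }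
  have hLb : L (b - a) = b' - a' := by
    have h1 : ((b 0 - a 0) * (c 1 - a 1) - (b 1 - a 1) * (c 0 - a 0)) / cr a b c = 1 :=
      div_self h
    have h2 : ((b 0 - a 0) * (b 1 - a 1) - (b 1 - a 1) * (b 0 - a 0)) / cr a b c = 0 := by
      rw [mul_comm, sub_self, zero_div]
    simp [L, h1, h2]
  have hLc : L (c - a) = c' - a' := by
    have h1 : ((b 0 - a 0) * (c 1 - a 1) - (b 1 - a 1) * (c 0 - a 0)) / cr a b c = 1 :=
      div_self h
    have h2 : ((c 0 - a 0) * (c 1 - a 1) - (c 1 - a 1) * (c 0 - a 0)) / cr a b c = 0 := by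
      rw [mul_comm, sub_self, zero_div]
    simp [L, h1, h2]
  have hn : ∀ x, ‖L x‖ = ‖x‖ := by
    intro x
    have hs : ‖L x‖ ^ 2 = ‖x‖ ^ 2 := by
      rw [EuclideanSpace.norm_sq_eq, EuclideanSpace.norm_sq_eq]
      simp only [Fin.sum_univ_two, Real.norm_eq_abs, sq_abs]
      simp only [L, LinearMap.coe_mk, AddHom.coe_mk, PiLp.add_apply, PiLp.smul_apply,
        PiLp.sub_apply, smul_eq_mul]
      generalize hD : cr a b c = D at h
      have hD' := hD
      simp only [sq, cr] at *
      set p := x 0 * (c 1 - a 1) - x 1 * (c 0 - a 0) with hp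
      set q := (b 0 - a 0) * x 1 - (b 1 - a 1) * x 0 with hq
      have key : (p * (b' 0 - a' 0) + q * (c' 0 - a' 0)) ^ 2
          + (p * (b' 1 - a' 1) + q * (c' 1 - a' 1)) ^ 2 = D ^ 2 * (x 0 ^ 2 + x 1 ^ 2) := by
        -- The two bases have the same Gram matrix, because the three side lengths determine the
        -- inner product by polarization.
        have e1 : (p * (b' 0 - a' 0) + q * (c' 0 - a' 0)) ^ 2
          + (p * (b' 1 - a' 1) + q * (c' 1 - a' 1)) ^ 2 =
          (p * (b 0 - a 0) + q * (c 0 - a 0)) ^ 2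
          + (p * (b 1 - a 1) + q * (c 1 - a 1)) ^ 2 := by
          linear_combination (p ^ 2 + p * q) * hab + (q ^ 2 + p * q) * hca - p * q * hbc
        rw [e1, ← hD, hp, hq]; ring
      field_simp
      linear_combination key
    exact (pow_left_inj₀ (norm_nonneg _) (norm_nonneg _) two_ne_zero).1 hs
  let LI : Plane →ₗᵢ[ℝ] Plane := ⟨L, hn⟩
  let LE := LI.toLinearIsometryEquiv rfl
  have hLE : ∀ x, LE x = L x := fun x => by simp [LE, LI]
  refine ⟨((IsometryEquiv.subRight a).trans LE.toIsometryEquiv).trans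
    (IsometryEquiv.addRight a'), ?_, ?_, ?_⟩
  · simp
  · simp [hLE, hLb]
  · simp [hLE, hLc]

theorem injective_of_not_collinear {t : Fin 3 → Plane} (h : ¬ Collinear ℝ (Set.range t)) :
    Function.Injective t := by
  rw [collinear_range_iff] at h
  intro i j hij
  by_contra hne
  apply h
  fin_cases i <;> fin_cases j <;> simp at hne hij <;> simp [cr, hij] <;> ring

/-- Replaces the isometry by squared side lengths matched through a permutation of the vertices;
`exists_isometryEquiv` supplies the isometry in the converse direction. -/
theorem sameTriangle_iff {P : Finset Plane} (s t : NoncollinearTriple P) :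
    sameTriangle P s t ↔
      ∃ σ : Equiv.Perm (Fin 3), ∀ i j, sq (t.1 (σ i)) (t.1 (σ j)) = sq (s.1 i) (s.1 j) := by
  constructor
  · rintro ⟨f, hf⟩
    have hs := injective_of_not_collinear s.2.2
    have hex : ∀ i, ∃ j, t.1 j = f (s.1 i) := fun i => by
      have : f (s.1 i) ∈ Set.range t.1 := hf ▸ ⟨_, ⟨i, rfl⟩, rfl⟩
      exact this
    choose g hg using hex
    have hinj : Function.Injective g := fun i j hij =>
      hs (f.injective (by rw [← hg, ← hg, hij]))
    refine ⟨Equiv.ofBijective g (Finite.injective_iff_bijective.1 hinj), fun i j => ?_⟩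
    simp [hg, sq_eq_dist_sq, f.isometry.dist_eq]
  · rintro ⟨σ, h⟩
    obtain ⟨f, h0, h1, h2⟩ := exists_isometryEquiv
      (fun hc => s.2.2 ((collinear_range_iff _).2 hc)) (h 0 1) (h 1 2) (h 2 0)
    refine ⟨f, ?_⟩
    have : f ∘ s.1 = t.1 ∘ σ := by
      funext i; fin_cases i <;> simp [h0, h1, h2]
    rw [← Set.range_comp, this, Set.range_comp, σ.surjective.range_eq, Set.image_univ]

/-- Both invariants are symmetric functions of the squared sides, the area by Heron's formula. -/
theorem sideSum_eq_of_sameTriangle {P : Finset Plane} {s t : NoncollinearTriple P}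
    (h : sameTriangle P s t) :
    sideSum (s.1 0) (s.1 1) (s.1 2) = sideSum (t.1 0) (t.1 1) (t.1 2) ∧
      cr (s.1 0) (s.1 1) (s.1 2) ^ 2 = cr (t.1 0) (t.1 1) (t.1 2) ^ 2 := by
  obtain ⟨σ, h⟩ := (sameTriangle_iff s t).1 h
  have e1 : ∑ i, ∑ j, sq (t.1 i) (t.1 j) = ∑ i, ∑ j, sq (s.1 i) (s.1 j) := by
    rw [← Equiv.sum_comp σ]
    refine Finset.sum_congr rfl fun i _ => ?_
    rw [← Equiv.sum_comp σ]
    exact Finset.sum_congr rfl fun j _ => h i j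
  have e2 : ∑ i, ∑ j, sq (t.1 i) (t.1 j) ^ 2 = ∑ i, ∑ j, sq (s.1 i) (s.1 j) ^ 2 := by
    rw [← Equiv.sum_comp σ]
    refine Finset.sum_congr rfl fun i _ => ?_
    rw [← Equiv.sum_comp σ]
    exact Finset.sum_congr rfl fun j _ => by rw [h i j]
  have tot : ∀ u : Fin 3 → Plane, ∑ i, ∑ j, sq (u i) (u j) = 2 * sideSum (u 0) (u 1) (u 2) := by
    intro u; simp only [Fin.sum_univ_three, sideSum, sq]; ring
  have heron : ∀ u : Fin 3 → Plane, 4 * cr (u 0) (u 1) (u 2) ^ 2 =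
      sideSum (u 0) (u 1) (u 2) ^ 2 - ∑ i, ∑ j, sq (u i) (u j) ^ 2 := by
    intro u; simp only [Fin.sum_univ_three, sideSum, sq, cr]; ring
  rw [tot, tot] at e1
  have e3 : sideSum (s.1 0) (s.1 1) (s.1 2) = sideSum (t.1 0) (t.1 1) (t.1 2) := by linarith
  refine ⟨e3, ?_⟩
  have := heron s.1
  have := heron t.1
  rw [e3] at *
  linarith

instance (P : Finset Plane) : Finite (NoncollinearTriple P) :=
  Finite.of_injective (fun (t : NoncollinearTriple P) (i : Fin 3) => (⟨t.1 i, t.2.1 i⟩ : P))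
    fun _ _ h => Subtype.ext (funext fun i => congrArg Subtype.val (congrFun h i))

/-! ### Passing from classes of triangles to pairs (area, side sum). -/

/-- The triangles spanned by `P` have only two possible pairs (area, sum of squared sides). -/
def Types (P : Finset Plane) (α σ β τ : ℝ) : Prop :=
  ∀ a ∈ P, ∀ b ∈ P, ∀ c ∈ P, 0 < cr a b c →
    (cr a b c = α ∧ sideSum a b c = σ) ∨ (cr a b c = β ∧ sideSum a b c = τ)

def mkTriple {P : Finset Plane} {a b c : Plane} (ha : a ∈ P) (hb : b ∈ P) (hc : c ∈ P)
    (h : cr a b c ≠ 0) : NoncollinearTriple P :=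
  ⟨![a, b, c], fun i => by fin_cases i <;> assumption,
    fun hcol => h (by simpa using (collinear_range_iff _).1 hcol)⟩

/-- The classes x and y may coincide, so this serves the counts one and two alike. -/
theorem Types.of_quotient {P : Finset Plane} (x y : Triangles P) (h : ∀ z, z = x ∨ z = y) :
    ∃ α σ β τ, Types P α σ β τ ∧ (x = y → α = β ∧ σ = τ) := by
  obtain ⟨s, rfl⟩ := Quotient.exists_rep x
  obtain ⟨t, rfl⟩ := Quotient.exists_rep y
  refine ⟨|cr (s.1 0) (s.1 1) (s.1 2)|, sideSum (s.1 0) (s.1 1) (s.1 2),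
    |cr (t.1 0) (t.1 1) (t.1 2)|, sideSum (t.1 0) (t.1 1) (t.1 2), ?_, fun hxy => ?_⟩
  · intro a ha b hb c hc hpos
    refine (h (Quotient.mk _ (mkTriple ha hb hc hpos.ne'))).imp ?_ ?_ <;>
    · intro he
      obtain ⟨h1, h2⟩ := sideSum_eq_of_sameTriangle (Quotient.exact he)
      simp only [mkTriple, Matrix.cons_val] at h1 h2
      exact ⟨by rw [← abs_of_pos hpos, (sq_eq_sq_iff_abs_eq_abs _ _).1 h2], h1⟩
  · obtain ⟨h1, h2⟩ := sideSum_eq_of_sameTriangle (Quotient.exact hxy)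
    exact ⟨(sq_eq_sq_iff_abs_eq_abs _ _).1 h2, h1⟩

theorem exists_types_of_numTriangles_eq_one {P : Finset Plane} (h : numTriangles P = 1) :
    ∃ α σ, Types P α σ α σ := by
  obtain ⟨h1, ⟨x⟩⟩ := Nat.card_eq_one_iff_unique.1 h
  obtain ⟨α, σ, β, τ, hT, he⟩ := Types.of_quotient x x fun z => Or.inl (Subsingleton.elim z x)
  obtain ⟨rfl, rfl⟩ := he rfl
  exact ⟨_, _, hT⟩

theorem exists_types_of_numTriangles_eq_two {P : Finset Plane} (h : numTriangles P = 2) :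
    ∃ α σ β τ, Types P α σ β τ := by
  obtain ⟨x, y, -, hxy⟩ := Nat.card_eq_two_iff.1 h
  obtain ⟨α, σ, β, τ, hT, -⟩ := Types.of_quotient x y fun z => by
    have : z ∈ ({x, y} : Set (Triangles P)) := hxy ▸ Set.mem_univ z
    simpa using this
  exact ⟨_, _, _, _, hT⟩

theorem exists_cr_pos_of_numTriangles_ne_zero {P : Finset Plane} (h : numTriangles P ≠ 0) :
    ∃ a ∈ P, ∃ b ∈ P, ∃ c ∈ P, 0 < cr a b c := by
  obtain ⟨⟨x⟩, -⟩ := Nat.card_ne_zero.1 h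
  obtain ⟨s, -⟩ := Quotient.exists_rep x
  have hs := fun hc => s.2.2 ((collinear_range_iff _).2 hc)
  rcases lt_or_gt_of_ne hs with hlt | hgt
  · refine ⟨_, s.2.1 1, _, s.2.1 0, _, s.2.1 2, ?_⟩
    simp only [cr] at *; linarith
  · exact ⟨_, s.2.1 0, _, s.2.1 1, _, s.2.1 2, hgt⟩

/-! ### Criteria for exactly one or exactly two triangles. -/

/-- The six ways in which the squared sides `x y z` may agree with `p q r` up to order. -/
def SameSides (x y z p q r : ℝ) : Prop :=
  (x = p ∧ y = q ∧ z = r) ∨ (x = p ∧ y = r ∧ z = q) ∨ (x = q ∧ y = p ∧ z = r) ∨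
  (x = q ∧ y = r ∧ z = p) ∨ (x = r ∧ y = p ∧ z = q) ∨ (x = r ∧ y = q ∧ z = p)

theorem sq_comm (a b : Plane) : sq a b = sq b a := by simp only [sq]; ring

theorem sq_self (a : Plane) : sq a a = 0 := by simp [sq]

theorem sameTriangle_of_sameSides {P : Finset Plane} {s t : NoncollinearTriple P} {p q r : ℝ}
    (ht : sq (t.1 0) (t.1 1) = p ∧ sq (t.1 1) (t.1 2) = q ∧ sq (t.1 2) (t.1 0) = r)
    (h : SameSides (sq (s.1 0) (s.1 1)) (sq (s.1 1) (s.1 2)) (sq (s.1 2) (s.1 0)) p q r) :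
    sameTriangle P s t := by
  rw [sameTriangle_iff]
  obtain ⟨rfl, rfl, rfl⟩ := ht
  have key : ∀ σ : Equiv.Perm (Fin 3),
      sq (s.1 0) (s.1 1) = sq (t.1 (σ 0)) (t.1 (σ 1)) →
      sq (s.1 1) (s.1 2) = sq (t.1 (σ 1)) (t.1 (σ 2)) →
      sq (s.1 2) (s.1 0) = sq (t.1 (σ 2)) (t.1 (σ 0)) →
      ∃ σ : Equiv.Perm (Fin 3), ∀ i j, sq (t.1 (σ i)) (t.1 (σ j)) = sq (s.1 i) (s.1 j) := by
    intro σ h0 h1 h2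
    refine ⟨σ, fun i j => ?_⟩
    have h0' := (sq_comm _ _).trans (h0.trans (sq_comm _ _))
    have h1' := (sq_comm _ _).trans (h1.trans (sq_comm _ _))
    have h2' := (sq_comm _ _).trans (h2.trans (sq_comm _ _))
    fin_cases i <;> fin_cases j <;> simp only [Fin.zero_eta, Fin.mk_one, Fin.reduceFinMk, sq_self] <;>
      symm <;> assumption
  have c : ∀ i j k : Fin 3, i ≠ j → j ≠ k → i ≠ k → ∃ σ : Equiv.Perm (Fin 3),
      σ 0 = i ∧ σ 1 = j ∧ σ 2 = k := by decide
  rcases h with ⟨h0, h1, h2⟩ | ⟨h0, h1, h2⟩ | ⟨h0, h1, h2⟩ | ⟨h0, h1, h2⟩ | ⟨h0, h1, h2⟩ |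
    ⟨h0, h1, h2⟩
  · obtain ⟨σ, e0, e1, e2⟩ := c 0 1 2 (by decide) (by decide) (by decide)
    exact key σ (by simp [*]) (by simp [*]) (by simp [*])
  · obtain ⟨σ, e0, e1, e2⟩ := c 1 0 2 (by decide) (by decide) (by decide)
    exact key σ (by rw [h0, e0, e1, sq_comm]) (by rw [h1, e1, e2, sq_comm])
      (by rw [h2, e2, e0, sq_comm])
  · obtain ⟨σ, e0, e1, e2⟩ := c 2 1 0 (by decide) (by decide) (by decide)
    exact key σ (by rw [h0, e0, e1, sq_comm]) (by rw [h1, e1, e2, sq_comm])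
      (by rw [h2, e2, e0, sq_comm])
  · obtain ⟨σ, e0, e1, e2⟩ := c 1 2 0 (by decide) (by decide) (by decide)
    exact key σ (by simp [*]) (by simp [*]) (by simp [*])
  · obtain ⟨σ, e0, e1, e2⟩ := c 2 0 1 (by decide) (by decide) (by decide)
    exact key σ (by simp [*]) (by simp [*]) (by simp [*])
  · obtain ⟨σ, e0, e1, e2⟩ := c 0 2 1 (by decide) (by decide) (by decide)
    exact key σ (by rw [h0, e0, e1, sq_comm]) (by rw [h1, e1, e2, sq_comm])
      (by rw [h2, e2, e0, sq_comm])

theorem numTriangles_eq_one {P : Finset Plane} {a b c : Plane} (ha : a ∈ P) (hb : b ∈ P)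
    (hc : c ∈ P) (h : cr a b c ≠ 0)
    (hP : ∀ x ∈ P, ∀ y ∈ P, ∀ z ∈ P, cr x y z ≠ 0 →
      SameSides (sq x y) (sq y z) (sq z x) (sq a b) (sq b c) (sq c a)) :
    numTriangles P = 1 := by
  refine Nat.card_eq_one_iff_unique.2 ⟨⟨?_⟩, ⟨Quotient.mk _ (mkTriple ha hb hc h)⟩⟩
  have : ∀ x : Triangles P, x = Quotient.mk _ (mkTriple ha hb hc h) := by
    intro x
    obtain ⟨s, rfl⟩ := Quotient.exists_rep x
    exact Quotient.sound (sameTriangle_of_sameSides ⟨rfl, rfl, rfl⟩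
      (hP _ (s.2.1 0) _ (s.2.1 1) _ (s.2.1 2)
        fun hc => s.2.2 ((collinear_range_iff _).2 hc)))
  intro x y; rw [this x, this y]

theorem numTriangles_eq_two {P : Finset Plane} {a b c a' b' c' : Plane} (ha : a ∈ P) (hb : b ∈ P)
    (hc : c ∈ P) (ha' : a' ∈ P) (hb' : b' ∈ P) (hc' : c' ∈ P)
    (h : cr a b c ≠ 0) (h' : cr a' b' c' ≠ 0) (hne : sideSum a b c ≠ sideSum a' b' c')
    (hP : ∀ x ∈ P, ∀ y ∈ P, ∀ z ∈ P, cr x y z ≠ 0 →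
      SameSides (sq x y) (sq y z) (sq z x) (sq a b) (sq b c) (sq c a) ∨
      SameSides (sq x y) (sq y z) (sq z x) (sq a' b') (sq b' c') (sq c' a')) :
    numTriangles P = 2 := by
  refine Nat.card_eq_two_iff.2 ⟨Quotient.mk _ (mkTriple ha hb hc h),
    Quotient.mk _ (mkTriple ha' hb' hc' h'), fun he => hne ?_, Set.eq_univ_of_forall fun x => ?_⟩
  · simpa [mkTriple] using (sideSum_eq_of_sameTriangle (Quotient.exact he)).1
  · obtain ⟨s, rfl⟩ := Quotient.exists_rep x
    refine (hP _ (s.2.1 0) _ (s.2.1 1) _ (s.2.1 2)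
        fun hc => s.2.2 ((collinear_range_iff _).2 hc)).imp (fun hs => ?_) (fun hs => ?_)
    · exact Quotient.sound (sameTriangle_of_sameSides ⟨rfl, rfl, rfl⟩ hs)
    · exact Quotient.sound (sameTriangle_of_sameSides ⟨rfl, rfl, rfl⟩ hs)

/-! ### Identities for signed areas and the two-value principle. -/

theorem cr_rotate (a b c : Plane) : cr b c a = cr a b c := by simp only [cr]; ring

theorem cr_swap (a b c : Plane) : cr b a c = -cr a b c := by simp only [cr]; ring

theorem cr_swap_right (a b c : Plane) : cr a c b = -cr a b c := by simp only [cr]; ring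

theorem cr_reverse (a b c : Plane) : cr c b a = -cr a b c := by simp only [cr]; ring

theorem cr_add (a b c d : Plane) : cr a b d + cr b c d + cr c a d = cr a b c := by
  simp only [cr]; ring

theorem ne_of_cr_ne_zero {a b c : Plane} (h : cr a b c ≠ 0) : a ≠ b ∧ b ≠ c ∧ a ≠ c := by
  refine ⟨?_, ?_, ?_⟩ <;> rintro rfl <;> apply h <;> simp only [cr] <;> ring

/-- Among two values, one of which exceeds another by addition, the summands agree. -/
theorem eq_of_add_mem_pair {x y α β : ℝ} (hx : 0 < x) (hy : 0 < y)
    (h1 : x = α ∨ x = β) (h2 : y = α ∨ y = β) (h3 : x + y = α ∨ x + y = β) : x = y := by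
  rcases h1 with h1 | h1 <;> rcases h2 with h2 | h2 <;> rcases h3 with h3 | h3 <;> linarith

theorem Types.cr_mem {P : Finset Plane} {α σ β τ : ℝ} (hT : Types P α σ β τ) {a b c : Plane}
    (ha : a ∈ P) (hb : b ∈ P) (hc : c ∈ P) (h : 0 < cr a b c) :
    cr a b c = α ∨ cr a b c = β :=
  (hT a ha b hb c hc h).imp And.left And.left

/-- When the two areas differ, the area alone decides the type. This is how equalities of areas
become metric information. -/
theorem Types.sideSum_eq {P : Finset Plane} {α σ β τ : ℝ} (hT : Types P α σ β τ)
    (hne : α ≠ β) {a b c a' b' c' : Plane}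
    (ha : a ∈ P) (hb : b ∈ P) (hc : c ∈ P) (ha' : a' ∈ P) (hb' : b' ∈ P) (hc' : c' ∈ P)
    (h : 0 < cr a b c) (he : cr a b c = cr a' b' c') : sideSum a b c = sideSum a' b' c' := by
  rcases hT a ha b hb c hc h with ⟨h1, h2⟩ | ⟨h1, h2⟩ <;>
  rcases hT a' ha' b' hb' c' hc' (he ▸ h) with ⟨h3, h4⟩ | ⟨h3, h4⟩
  · rw [h2, h4]
  · exact absurd (h1.symm.trans (he.trans h3)) hne
  · exact absurd (h3.symm.trans (he.symm.trans h1)) hne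
  · rw [h2, h4]

/-- Two points with the same pair of independent signed areas over `a`, `b`, `c` agree. -/
theorem eq_of_cr_eq {a b c d e : Plane} (h : cr a b c ≠ 0) (h1 : cr a b d = cr a b e)
    (h2 : cr b c d = cr b c e) : d = e := by
  apply plane_ext <;> apply mul_left_cancel₀ h <;> simp only [cr] at *
  · linear_combination (c 0 - b 0) * h1 - (b 0 - a 0) * h2
  · linear_combination (c 1 - b 1) * h1 - (b 1 - a 1) * h2

/-! ### Sets with three collinear points. -/

variable {P : Finset Plane} {α σ β τ : ℝ}

/-- The middle one of three collinear points is the midpoint and the other points are equidistant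
from the outer two. -/
theorem Types.of_between (hT : Types P α σ β τ) {a b c d : Plane}
    (ha : a ∈ P) (hb : b ∈ P) (hc : c ∈ P) (hd : d ∈ P) (h0 : cr a b c = 0)
    (h1 : 0 < cr a b d) (h2 : 0 < cr b c d) :
    α ≠ β ∧ cr a b d = cr b c d ∧ (∀ i, a i + c i = 2 * b i) ∧ sq a d = sq c d ∧
      α + β = 3 * cr a b d ∧ α * β = 2 * cr a b d ^ 2 := by
  have hs : cr a c d = cr a b d + cr b c d := by
    have := cr_add a b c d
    rw [cr_swap a c d] at this; linarith
  have h3 : 0 < cr a c d := by linarith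
  have m1 := hT.cr_mem ha hb hd h1
  have m2 := hT.cr_mem hb hc hd h2
  have m3 := hT.cr_mem ha hc hd h3
  rw [hs] at m3
  have e := eq_of_add_mem_pair h1 h2 m1 m2 m3
  -- The summands take one value and their sum takes the other, so the two values are x and 2x.
  have hab : α ≠ β ∧ α + β = 3 * cr a b d ∧ α * β = 2 * cr a b d ^ 2 := by
    rw [← e] at m3
    rcases m1 with m1 | m1 <;> rcases m3 with m3 | m3
    · linarith
    · exact ⟨fun h => by linarith, by linarith, by rw [← m3, ← m1]; ring⟩
    · exact ⟨fun h => by linarith, by linarith, by rw [← m3, ← m1]; ring⟩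
    · linarith
  have hmid : ∀ i, a i + c i = 2 * b i := by
    have e' := e
    have k := h1.ne'
    simp only [cr] at e' h0 k
    have i0 : a 0 + c 0 = 2 * b 0 := by
      apply mul_left_cancel₀ k
      linear_combination (-(b 0 - a 0)) * e' - (b 0 - d 0) * h0
    have i1 : a 1 + c 1 = 2 * b 1 := by
      apply mul_left_cancel₀ k
      linear_combination (-(b 1 - a 1)) * e' - (b 1 - d 1) * h0
    intro i; fin_cases i
    · exact i0
    · exact i1
  refine ⟨hab.1, e, hmid, ?_, hab.2⟩
  -- The triangles abd and bcd share the side bd and have equal bases ab and bc, so equal side sums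
  -- leave ad = cd.
  have hS := hT.sideSum_eq hab.1 ha hb hd hb hc hd h1 e
  have i0 := hmid 0
  have i1 := hmid 1
  simp only [sideSum] at hS
  have : sq a b = sq b c := by
    simp only [sq]
    rw [show c 0 = 2 * b 0 - a 0 by linarith, show c 1 = 2 * b 1 - a 1 by linarith]; ring
  rw [sq_comm d a, sq_comm d b] at hS
  linarith

/-- `of_between` without an orientation. -/
theorem Types.of_between' (hT : Types P α σ β τ) {a b c d : Plane}
    (ha : a ∈ P) (hb : b ∈ P) (hc : c ∈ P) (hd : d ∈ P) (h0 : cr a b c = 0)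
    (h1 : 0 < cr a b d * cr b c d) :
    α ≠ β ∧ (∀ i, a i + c i = 2 * b i) ∧ sq a d = sq c d ∧
      α + β = 3 * |cr a b d| ∧ α * β = 2 * |cr a b d| ^ 2 := by
  rcases mul_pos_iff.1 h1 with ⟨p, q⟩ | ⟨p, q⟩
  · obtain ⟨k1, k2, k3, k4, k5, k6⟩ := hT.of_between ha hb hc hd h0 p q
    rw [abs_of_pos p]
    exact ⟨k1, k3, k4, k5, k6⟩
  · have e1 : cr c b d = -cr b c d := cr_swap _ _ _
    have e2 : cr b a d = -cr a b d := cr_swap _ _ _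
    obtain ⟨k1, k2, k3, k4, k5, k6⟩ := hT.of_between hc hb ha hd
      (by rw [cr_reverse, h0, neg_zero]) (by linarith) (by linarith)
    rw [abs_of_neg p]
    rw [k2, e2] at k5 k6
    exact ⟨k1, fun i => by rw [add_comm, k3], k4.symm, k5, k6⟩

/-- Two of three nonzero reals have the same sign; the point shared by the two corresponding
segments is the middle one. -/
theorem Types.exists_midpoint (hT : Types P α σ β τ) {a b c d : Plane}
    (ha : a ∈ P) (hb : b ∈ P) (hc : c ∈ P) (hd : d ∈ P) (h0 : cr a b c = 0)
    (h1 : cr a b d ≠ 0) (h2 : cr b c d ≠ 0) (h3 : cr c a d ≠ 0) :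
    (0 < cr a b d * cr b c d ∧ ∀ i, a i + c i = 2 * b i) ∨
    (0 < cr b c d * cr c a d ∧ ∀ i, b i + a i = 2 * c i) ∨
    (0 < cr c a d * cr a b d ∧ ∀ i, c i + b i = 2 * a i) := by
  have k0 : cr b c a = 0 := by rw [cr_rotate, h0]
  have k1 : cr c a b = 0 := by rw [cr_rotate, k0]
  by_cases p1 : 0 < cr a b d * cr b c d
  · exact Or.inl ⟨p1, (hT.of_between' ha hb hc hd h0 p1).2.1⟩
  by_cases p2 : 0 < cr b c d * cr c a d
  · exact Or.inr (Or.inl ⟨p2, (hT.of_between' hb hc ha hd k0 p2).2.1⟩)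
  by_cases p3 : 0 < cr c a d * cr a b d
  · exact Or.inr (Or.inr ⟨p3, (hT.of_between' hc ha hb hd k1 p3).2.1⟩)
  exfalso
  have q1 := lt_of_le_of_ne (not_lt.1 p1) (mul_ne_zero h1 h2)
  have q2 := lt_of_le_of_ne (not_lt.1 p2) (mul_ne_zero h2 h3)
  have q3 := lt_of_le_of_ne (not_lt.1 p3) (mul_ne_zero h3 h1)
  have := mul_pos_of_neg_of_neg q1 q2
  have := mul_neg_of_pos_of_neg this q3
  nlinarith [sq_nonneg (cr a b d * cr b c d * cr c a d)]

theorem cr_ne_zero_of_collinear {a b c d : Plane} (h0 : cr a b c = 0)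
    (hbc : b ≠ c) (h : cr a b d ≠ 0) : cr b c d ≠ 0 := by
  intro h'
  apply h
  have hp := (sq_pos hbc).ne'
  simp only [cr, sq] at *
  apply mul_left_cancel₀ hp
  linear_combination ((b 0 - a 0) * (b 0 - c 0) + (b 1 - a 1) * (b 1 - c 1)) * (-h') +
    ((d 0 - b 0) * (c 0 - b 0) + (d 1 - b 1) * (c 1 - b 1)) * h0

theorem inner_sub_sub (a b c d : Plane) :
    inner ℝ (b - a) (d - c) = (b 0 - a 0) * (d 0 - c 0) + (b 1 - a 1) * (d 1 - c 1) := by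
  simp [PiLp.inner_apply, Fin.sum_univ_two]; ring

theorem exists_mem_not_mem_of_card {P : Finset Plane} (l : List Plane) (h : l.length < P.card) :
    ∃ x ∈ P, x ∉ l := by
  classical
  obtain ⟨x, hx, hxl⟩ := Finset.exists_mem_notMem_of_card_lt_card
    (lt_of_le_of_lt (List.toFinset_card_le l) h)
  exact ⟨x, hx, by simpa using hxl⟩

/-- A fourth point f on the line is impossible. With a, b, c at 1, 0, -1, the midpoint in the triple
c, a, f allows only f = 0, 3, -3, and that in b, c, f only f = -1/2, -2, 1. -/
theorem Types.cr_ne_zero_of_midpoint (hT : Types P α σ β τ) {a b c d f : Plane}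
    (ha : a ∈ P) (hb : b ∈ P) (hc : c ∈ P) (hd : d ∈ P) (hf : f ∈ P)
    (hmid : ∀ i, a i + c i = 2 * b i) (h : cr a b d ≠ 0)
    (hfa : f ≠ a) (hfb : f ≠ b) (hfc : f ≠ c) : cr a b f ≠ 0 := by
  intro h0
  have m0 := hmid 0
  have m1 := hmid 1
  have hab := (ne_of_cr_ne_zero h).1
  have hbc : b ≠ c := fun hbc => hab (plane_ext (by rw [← hbc] at m0; linarith)
    (by rw [← hbc] at m1; linarith))
  have hbcd : cr b c d ≠ 0 := by
    refine cr_ne_zero_of_collinear ?_ hbc h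
    simp only [cr]; rw [show c 0 = 2 * b 0 - a 0 by linarith, show c 1 = 2 * b 1 - a 1 by linarith]
    ring
  have hacd : cr c a d ≠ 0 := by
    have : cr c a d = -2 * cr a b d := by
      simp only [cr]
      rw [show c 0 = 2 * b 0 - a 0 by linarith, show c 1 = 2 * b 1 - a 1 by linarith]
      ring
    rw [this]; exact mul_ne_zero (by norm_num) h
  have hcaf : cr c a f = 0 := by
    have : cr c a f = -2 * cr a b f := by
      simp only [cr]
      rw [show c 0 = 2 * b 0 - a 0 by linarith, show c 1 = 2 * b 1 - a 1 by linarith]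
      ring
    rw [this, h0, mul_zero]
  have hbcf : cr b c f = 0 := by
    have : cr b c f = cr a b f := by
      simp only [cr]
      rw [show c 0 = 2 * b 0 - a 0 by linarith, show c 1 = 2 * b 1 - a 1 by linarith]
      ring
    rw [this, h0]
  have hafd : cr a f d ≠ 0 := cr_ne_zero_of_collinear hcaf hfa.symm hacd
  have hcfd : cr c f d ≠ 0 := cr_ne_zero_of_collinear hbcf hfc.symm hbcd
  have hfcd : cr f c d ≠ 0 :=
    cr_ne_zero_of_collinear (by rw [cr_rotate, hcaf]) hfc hafd
  have hfbd : cr f b d ≠ 0 :=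
    cr_ne_zero_of_collinear (by rw [cr_rotate, hbcf]) hfb hcfd
  rcases hT.exists_midpoint hc ha hf hd hcaf hacd hafd hfcd with ⟨-, e⟩ | ⟨-, e⟩ | ⟨-, e⟩ <;>
  rcases hT.exists_midpoint hb hc hf hd hbcf hbcd hcfd hfbd with ⟨-, e'⟩ | ⟨-, e'⟩ | ⟨-, e'⟩ <;>
  have e0 := e 0 <;> have e1 := e 1 <;> have e0' := e' 0 <;> have e1' := e' 1 <;>
  exact hfb (plane_ext (by linarith) (by linarith))

/-- Every point off the line ac lies on the perpendicular bisector of ac, at a distance fixed by α +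
β = 3|`cr a b x`|. So there are at most two of them, symmetric about b, and
`Types.cr_ne_zero_of_midpoint` leaves no further point on the line. -/
theorem Types.isSquareWithCenter_of_midpoint (hT : Types P α σ β τ) (hcard : 5 ≤ P.card)
    {a b c d : Plane} (ha : a ∈ P) (hb : b ∈ P) (hc : c ∈ P) (hd : d ∈ P)
    (hmid : ∀ i, a i + c i = 2 * b i) (h : cr a b d ≠ 0) : IsSquareWithCenter P := by
  have m0 := hmid 0
  have m1 := hmid 1
  have c0 : c 0 = 2 * b 0 - a 0 := by linarith
  have c1 : c 1 = 2 * b 1 - a 1 := by linarith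
  have habc : cr a b c = 0 := by simp only [cr]; rw [c0, c1]; ring
  have hbc : ∀ x, cr b c x = cr a b x := by intro x; simp only [cr]; rw [c0, c1]; ring
  have bis : ∀ x ∈ P, cr a b x ≠ 0 → α ≠ β ∧ sq a x = sq c x ∧
      α + β = 3 * |cr a b x| := by
    intro x hx hx0
    obtain ⟨h1, -, h2, h3, -⟩ := hT.of_between' ha hb hc hx habc
      (by rw [hbc]; exact mul_self_pos.2 hx0)
    exact ⟨h1, h2, h3⟩
  have hp := (sq_pos (ne_of_cr_ne_zero h).1).ne'
  have perp : ∀ x, sq a x = sq c x →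
      (x 0 - b 0) * (a 0 - b 0) + (x 1 - b 1) * (a 1 - b 1) = 0 := by
    intro x hx; simp only [sq, c0, c1] at hx; linarith
  have uniq : ∀ x ∈ P, ∀ y ∈ P, cr a b x ≠ 0 → cr a b x = cr a b y → x = y := by
    intro x hx y hy hx0 hxy
    have e1 := perp x (bis x hx hx0).2.1
    have e2 := perp y (bis y hy (hxy ▸ hx0)).2.1
    simp only [cr, sq] at hxy hp
    apply plane_ext <;> apply mul_left_cancel₀ hp
    · linear_combination (a 0 - b 0) * e1 - (a 0 - b 0) * e2 + (a 1 - b 1) * hxy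
    · linear_combination (a 1 - b 1) * e1 - (a 1 - b 1) * e2 - (a 0 - b 0) * hxy
  have hopp : ∀ x ∈ P, ∀ y ∈ P, cr a b x ≠ 0 → cr a b y ≠ 0 → x ≠ y →
      cr a b y = - cr a b x := by
    intro x hx y hy hx0 hy0 hxy
    have e1 := (bis x hx hx0).2.2
    have e2 := (bis y hy hy0).2.2
    rcases abs_eq_abs.1 (show |cr a b y| = |cr a b x| by linarith) with e | e
    · exact absurd (uniq y hy x hx hy0 e).symm hxy
    · exact e
  have core : ∀ d ∈ P, ∀ f ∈ P, 0 < cr a b d → cr a b f = - cr a b d →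
      IsSquareWithCenter P := by
    intro d hd f hf hpos hfd
    have hf0 : cr a b f ≠ 0 := by rw [hfd]; exact neg_ne_zero.2 hpos.ne'
    have e1 := perp d (bis d hd hpos.ne').2.1
    have e2 := perp f (bis f hf hf0).2.1
    have f0 : f 0 = 2 * b 0 - d 0 := by
      simp only [cr, sq] at hfd hp
      apply mul_left_cancel₀ hp
      linear_combination (a 0 - b 0) * e1 + (a 0 - b 0) * e2 + (a 1 - b 1) * hfd
    have f1 : f 1 = 2 * b 1 - d 1 := by
      simp only [cr, sq] at hfd hp
      apply mul_left_cancel₀ hp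
      linear_combination (a 1 - b 1) * e1 + (a 1 - b 1) * e2 - (a 0 - b 0) * hfd
    have k1 : cr a f d = 2 * cr a b d := by simp only [cr]; rw [f0, f1]; ring
    have k2 : cr a c d = 2 * cr a b d := by simp only [cr]; rw [c0, c1]; ring
    -- In the parallelogram a f c d the triangles afd and acd have equal area; equal side sums make
    -- the diagonals fd and ac equal, which gives the right angle.
    have hS := hT.sideSum_eq (bis d hd hpos.ne').1 ha hf hd ha hc hd (by linarith)
      (k1.trans k2.symm)
    have hdist := (bis d hd hpos.ne').2.1
    refine ⟨a, f, c, d, ⟨⟨(ne_of_cr_ne_zero hf0).2.2, (ne_of_cr_ne_zero hpos.ne').2.2, ?_, ?_⟩, ?_⟩, ?_⟩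
    · apply plane_ext
      · simp only [PiLp.sub_apply]; linarith
      · simp only [PiLp.sub_apply]; linarith
    · rw [inner_sub_sub]
      simp only [sideSum, sq, f0, f1, c0, c1] at hS ⊢
      linarith
    · apply dist_eq_of_sq_eq
      rw [hdist]
      simp only [sq, f0, f1, c0, c1]; ring
    · have hb' : midpoint ℝ a c = b := by
        apply plane_ext <;> simp [midpoint_eq_smul_add] <;> linarith
      rw [hb']
      ext x
      simp only [Finset.mem_coe, Set.mem_insert_iff, Set.mem_singleton_iff]
      constructor
      · intro hx
        by_contra! hne
        obtain ⟨n1, n2, n3, n4, n5⟩ := hne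
        have hx0 := hT.cr_ne_zero_of_midpoint ha hb hc hd hx hmid hpos.ne' n1 n5 n3
        have := hopp x hx d hd hx0 hpos.ne' n4
        have := hopp x hx f hf hx0 hf0 n2
        linarith
      · rintro (rfl | rfl | rfl | rfl | rfl) <;> assumption
  obtain ⟨f, hf, hfl⟩ := exists_mem_not_mem_of_card [a, b, c, d]
    (lt_of_lt_of_le (by simp) hcard)
  simp only [List.mem_cons, List.not_mem_nil, or_false, not_or] at hfl
  have hf0 := hT.cr_ne_zero_of_midpoint ha hb hc hd hf hmid h hfl.1 hfl.2.1 hfl.2.2.1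
  have hfd := hopp d hd f hf h hf0 (Ne.symm hfl.2.2.2)
  rcases lt_or_gt_of_ne h with hlt | hgt
  · exact core f hf d hd (by linarith) (by linarith)
  · exact core d hd f hf hgt hfd

theorem Types.isSquareWithCenter_of_collinear (hT : Types P α σ β τ) (hcard : 5 ≤ P.card)
    {a b c d : Plane} (ha : a ∈ P) (hb : b ∈ P) (hc : c ∈ P) (hd : d ∈ P)
    (hbc : b ≠ c) (hca : c ≠ a) (h0 : cr a b c = 0) (h : cr a b d ≠ 0) :
    IsSquareWithCenter P := by
  have h1 := cr_ne_zero_of_collinear h0 hbc h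
  have h2 := cr_ne_zero_of_collinear (by rw [cr_rotate, h0]) hca h1
  rcases hT.exists_midpoint ha hb hc hd h0 h h1 h2 with ⟨-, e⟩ | ⟨-, e⟩ | ⟨-, e⟩
  · exact hT.isSquareWithCenter_of_midpoint hcard ha hb hc hd e h
  · exact hT.isSquareWithCenter_of_midpoint hcard hb hc ha hd e h1
  · exact hT.isSquareWithCenter_of_midpoint hcard hc ha hb hd e h2

/-! ### General position: interior points and convex position. -/

/-- No three points of `P` are collinear. -/
def GeneralPosition (P : Finset Plane) : Prop :=
  ∀ a ∈ P, ∀ b ∈ P, ∀ c ∈ P, a ≠ b → b ≠ c → c ≠ a → cr a b c ≠ 0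

/-- No point of `P` lies inside a triangle with vertices in `P`. -/
def NoInteriorPoint (P : Finset Plane) : Prop :=
  ∀ a ∈ P, ∀ b ∈ P, ∀ c ∈ P, ∀ d ∈ P, 0 < cr a b d → 0 < cr b c d → 0 < cr c a d → False

/-- `a b c d` is a convex quadrilateral, traversed counterclockwise. -/
structure ConvexQuad (a b c d : Plane) : Prop where
  abc : 0 < cr a b c
  bcd : 0 < cr b c d
  cda : 0 < cr c d a
  dab : 0 < cr d a b

/-- `a b c d e` is a convex pentagon, traversed counterclockwise. -/
structure ConvexPentagon (a b c d e : Plane) : Prop where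
  eab : 0 < cr e a b
  abc : 0 < cr a b c
  bcd : 0 < cr b c d
  cde : 0 < cr c d e
  dea : 0 < cr d e a
  acd : 0 < cr a c d
  bde : 0 < cr b d e
  cea : 0 < cr c e a
  dab : 0 < cr d a b
  ebc : 0 < cr e b c

theorem Types.abs_cr (hT : Types P α σ β τ) {a b c : Plane}
    (ha : a ∈ P) (hb : b ∈ P) (hc : c ∈ P) (h : cr a b c ≠ 0) :
    (|cr a b c| = α ∧ sideSum a b c = σ) ∨ (|cr a b c| = β ∧ sideSum a b c = τ) := by
  rcases lt_or_gt_of_ne h with hlt | hgt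
  · have := hT b hb a ha c hc (by rw [cr_swap]; linarith)
    rw [cr_swap] at this
    rw [abs_of_neg hlt]
    have hs : sideSum b a c = sideSum a b c := by simp only [sideSum, sq]; ring
    rwa [hs] at this
  · rw [abs_of_pos hgt]; exact hT a ha b hb c hc hgt

theorem eq_of_equidistant {a b c d e : Plane} (h : cr a b c ≠ 0)
    (h1 : sq d a = sq d b) (h2 : sq d b = sq d c) (h3 : sq e a = sq e b) (h4 : sq e b = sq e c) :
    d = e := by
  have h' : 2 * cr a b c ≠ 0 := mul_ne_zero two_ne_zero h
  simp only [cr, sq] at *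
  apply plane_ext <;> apply mul_left_cancel₀ h'
  · linear_combination (c 1 - b 1) * (h1 - h3) - (b 1 - a 1) * (h2 - h4)
  · linear_combination (-(c 0 - b 0)) * (h1 - h3) + (b 0 - a 0) * (h2 - h4)

theorem eq_of_add_add_mem_pair {x y z α β : ℝ} (hx : 0 < x) (hy : 0 < y) (hz : 0 < z)
    (h1 : x = α ∨ x = β) (h2 : y = α ∨ y = β) (h3 : z = α ∨ z = β)
    (h4 : x + y + z = α ∨ x + y + z = β) : x = y ∧ y = z ∧ α ≠ β := by
  rcases h1 with h1 | h1 <;> rcases h2 with h2 | h2 <;> rcases h3 with h3 | h3 <;>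
    rcases h4 with h4 | h4 <;>
    first
    | (exfalso; linarith)
    | exact ⟨by linarith, by linarith, fun _ => by linarith⟩

/-- An interior point d splits abc into three triangles of equal area and equal side sum. So d is
the centroid and abc is equilateral with center d, which determines both types and leaves no
position for a fifth point e. -/
theorem Types.noInteriorPoint (hT : Types P α σ β τ) (hG : GeneralPosition P)
    (hcard : 5 ≤ P.card) : NoInteriorPoint P := by
  intro a ha b hb c hc d hd h1 h2 h3
  have hsum := cr_add a b c d
  have habc : 0 < cr a b c := by linarith
  have m4 := hT.cr_mem ha hb hc habc
  rw [← hsum] at m4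
  obtain ⟨e1, e2, hne⟩ := eq_of_add_add_mem_pair h1 h2 h3 (hT.cr_mem ha hb hd h1)
    (hT.cr_mem hb hc hd h2) (hT.cr_mem hc ha hd h3) m4
  have s1 := hT.sideSum_eq hne ha hb hd hb hc hd h1 e1
  have s2 := hT.sideSum_eq hne hb hc hd hc ha hd h2 e2
  have g0 : a 0 + b 0 + c 0 = 3 * d 0 := by
    apply mul_left_cancel₀ h2.ne'
    simp only [cr] at e1 e2 ⊢
    linear_combination (b 0 - d 0) * e2 - (c 0 - d 0) * e1
  have g1 : a 1 + b 1 + c 1 = 3 * d 1 := by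
    apply mul_left_cancel₀ h2.ne'
    simp only [cr] at e1 e2 ⊢
    linear_combination (b 1 - d 1) * e2 - (c 1 - d 1) * e1
  have q0 : c 0 = 3 * d 0 - a 0 - b 0 := by linarith
  have q1 : c 1 = 3 * d 1 - a 1 - b 1 := by linarith
  have r1 : sq d a = sq d c := by simp only [sideSum, sq, q0, q1] at *; linarith
  have r2 : sq d b = sq d a := by simp only [sideSum, sq, q0, q1] at *; linarith
  have l1 : sq a b = 3 * sq d a := by simp only [sq, q0, q1] at *; linarith
  have l2 : sq b c = 3 * sq d a := by simp only [sq, q0, q1] at *; linarith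
  have l3 : sq c a = 3 * sq d a := by simp only [sq, q0, q1] at *; linarith
  obtain ⟨e, he, hel⟩ := exists_mem_not_mem_of_card [a, b, c, d]
    (lt_of_lt_of_le (by simp) hcard)
  simp only [List.mem_cons, List.not_mem_nil, or_false, not_or] at hel
  obtain ⟨ea, eb, ec, ed⟩ := hel
  obtain ⟨nab, nbc, nac⟩ := ne_of_cr_ne_zero habc.ne'
  have hRpos := sq_pos (ne_of_cr_ne_zero h1.ne').2.2
  rw [sq_comm] at hRpos
  generalize hR : sq d a = R at *
  -- With T the doubled area of abd and R the squared circumradius, the two types are (T, 5R) for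
  -- the small triangles and (3T, 9R) for abc.
  have kind : ∀ x ∈ P, ∀ y ∈ P, x ≠ y → e ≠ x → e ≠ y → cr x y d = cr a b d → sq x y = 3 * R →
      sq d x = R → sq d y = R →
      (|cr x y e| = cr a b d ∧ sq e x + sq e y = 2 * R) ∨
      (|cr x y e| = 3 * cr a b d ∧ sq e x + sq e y = 6 * R) := by
    intro x hx y hy hxy hex hey hxyd hxy' hdx hdy
    have t1 := hT a ha b hb c hc habc
    have t2 := hT x hx y hy d hd (by rw [hxyd]; exact h1)
    have t3 := hT.abs_cr hx hy he (hG x hx y hy e he hxy hey.symm hex)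
    have S1 : sideSum a b c = 9 * R := by simp only [sideSum]; linarith
    have S2 : sideSum x y d = 5 * R := by simp only [sideSum]; rw [sq_comm y d]; linarith
    have S3 : sideSum x y e = 3 * R + (sq e x + sq e y) := by
      simp only [sideSum]; rw [sq_comm y e]; linarith
    rw [S1] at t1
    rw [S2] at t2
    rw [S3] at t3
    rcases t1 with ⟨t1, u1⟩ | ⟨t1, u1⟩ <;> rcases t2 with ⟨t2, u2⟩ | ⟨t2, u2⟩ <;>
    rcases t3 with ⟨t3, u3⟩ | ⟨t3, u3⟩ <;>
    first
    | (exfalso; linarith)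
    | exact Or.inl ⟨by linarith, by linarith⟩
    | exact Or.inr ⟨by linarith, by linarith⟩
  have k1 := kind a ha b hb nab ea eb rfl l1 hR r2
  have k2 := kind b hb c hc nbc eb ec e1.symm l2 r2 r1.symm
  have k3 := kind c hc a ha nac.symm ec ea (by linarith) l3 r1.symm hR
  have hes := cr_add a b c e
  have fin : sq e a = sq e b → sq e b = sq e c → False := fun f1 f2 =>
    ed (eq_of_equidistant habc.ne' f1 f2 (by linarith) (by linarith))
  have pa := sq_pos ea
  have pb := sq_pos eb
  have pc := sq_pos ec
  -- Three equal sums make e the circumcenter d. Sums 2R, 2R, 6R would make a squared distance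
  -- negative. Sums 2R, 6R, 6R would need ±T ± 3T ± 3T = 3T.
  rcases k1 with ⟨k1, u1⟩ | ⟨k1, u1⟩ <;> rcases k2 with ⟨k2, u2⟩ | ⟨k2, u2⟩ <;>
    rcases k3 with ⟨k3, u3⟩ | ⟨k3, u3⟩ <;>
    first
    | (exfalso; linarith)
    | exact fin (by linarith) (by linarith)
    | (exfalso
       rcases abs_choice (cr a b e) with v1 | v1 <;> rcases abs_choice (cr b c e) with v2 | v2 <;>
       rcases abs_choice (cr c a e) with v3 | v3 <;> rw [v1] at k1 <;> rw [v2] at k2 <;>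
       rw [v3] at k3 <;> linarith)

/-- The signs of d against the three sides of abc decide: beyond no side, d is interior; beyond two
sides, a vertex is interior to a triangle with d; beyond exactly one side, the quadrilateral is
convex. -/
theorem NoInteriorPoint.exists_convexQuad (hI : NoInteriorPoint P) (hG : GeneralPosition P)
    (hcard : 4 ≤ P.card) : ∃ a ∈ P, ∃ b ∈ P, ∃ c ∈ P, ∃ d ∈ P, ConvexQuad a b c d := by
  obtain ⟨a, ha, -⟩ := exists_mem_not_mem_of_card (P := P) [] (by simp only [List.length]; omega)
  obtain ⟨b, hb, hbl⟩ := exists_mem_not_mem_of_card (P := P) [a] (by simp only [List.length]; omega)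
  obtain ⟨c, hc, hcl⟩ := exists_mem_not_mem_of_card (P := P) [a, b] (by simp only [List.length]; omega)
  obtain ⟨d, hd, hdl⟩ := exists_mem_not_mem_of_card (P := P) [a, b, c] (by simp only [List.length]; omega)
  simp only [List.mem_cons, List.not_mem_nil, or_false, not_or] at hbl hcl hdl
  have main : ∀ a ∈ P, ∀ b ∈ P, ∀ c ∈ P, 0 < cr a b c → d ≠ a → d ≠ b → d ≠ c →
      ∃ a ∈ P, ∃ b ∈ P, ∃ c ∈ P, ∃ d ∈ P, ConvexQuad a b c d := by
    intro a ha b hb c hc h da db dc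
    obtain ⟨nab, nbc, nac⟩ := ne_of_cr_ne_zero h.ne'
    have key : ∀ a ∈ P, ∀ b ∈ P, ∀ c ∈ P, 0 < cr a b c → cr c a d < 0 → 0 < cr a b d →
        0 < cr b c d → ∃ a ∈ P, ∃ b ∈ P, ∃ c ∈ P, ∃ d ∈ P, ConvexQuad a b c d := by
      intro a ha b hb c hc h h1 h2 h3
      exact ⟨a, ha, b, hb, c, hc, d, hd, h, h3, by rw [cr_swap_right]; linarith,
        by rwa [← cr_rotate]⟩
    have two : ∀ a ∈ P, ∀ b ∈ P, ∀ c ∈ P, 0 < cr a b c → cr c a d < 0 → cr a b d < 0 → False := by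
      intro a ha b hb c hc h h1 h2
      refine hI b hb c hc d hd a ha (by rwa [cr_rotate]) ?_ ?_
      · rw [cr_swap_right]; linarith
      · rw [← cr_rotate d b a, cr_swap]; linarith
    have hb' : 0 < cr b c a := by rwa [cr_rotate]
    have hc' : 0 < cr c a b := by rwa [cr_rotate]
    rcases lt_or_gt_of_ne (hG a ha b hb d hd nab db.symm da) with u | u <;>
    rcases lt_or_gt_of_ne (hG b hb c hc d hd nbc dc.symm db) with v | v <;>
    rcases lt_or_gt_of_ne (hG c hc a ha d hd nac.symm da.symm dc) with w | w
    · exact (two a ha b hb c hc h w u).elim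
    · exact (two b hb c hc a ha hb' u v).elim
    · exact (two a ha b hb c hc h w u).elim
    · exact key b hb c hc a ha hb' u v w
    · exact (two c hc a ha b hb hc' v w).elim
    · exact key c hc a ha b hb hc' v w u
    · exact key a ha b hb c hc h w u v
    · exact (hI a ha b hb c hc d hd u v w).elim
  rcases lt_or_gt_of_ne (hG a ha b hb c hc (Ne.symm hbl) (Ne.symm hcl.2) hcl.1) with h | h
  · exact main b hb a ha c hc (by rw [cr_swap]; linarith) hdl.2.1 hdl.1 hdl.2.2
  · exact main a ha b hb c hc h hdl.1 hdl.2.1 hdl.2.2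

/-- If e were beyond a second side too, the vertex common to the two sides would lie inside the
triangle formed by e and the other two vertices. -/
theorem NoInteriorPoint.beyond_side (hI : NoInteriorPoint P) (hG : GeneralPosition P)
    {p q r e : Plane} (hp : p ∈ P) (hq : q ∈ P) (hr : r ∈ P) (he : e ∈ P)
    (h : 0 < cr p q r) (hep : e ≠ p) (heq : e ≠ q) (her : e ≠ r) (hneg : cr r p e < 0) :
    0 < cr p q e ∧ 0 < cr q r e := by
  obtain ⟨n1, n2, n3⟩ := ne_of_cr_ne_zero h.ne'
  constructor
  · refine lt_of_not_ge fun hle => ?_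
    have hlt := lt_of_le_of_ne hle (hG p hp q hq e he n1 heq.symm hep)
    refine hI q hq r hr e he p hp (by rwa [cr_rotate]) ?_ ?_
    · rw [cr_swap_right]; linarith
    · rw [← cr_rotate e q p, cr_swap]; linarith
  · refine lt_of_not_ge fun hle => ?_
    have hlt := lt_of_le_of_ne hle (hG q hq r hr e he n2 her.symm heq)
    refine hI p hp q hq e he r hr h ?_ ?_
    · rw [cr_swap_right]; linarith
    · rw [← cr_rotate e p r, cr_swap]; linarith

theorem ConvexQuad.rotate {a b c d : Plane} (h : ConvexQuad a b c d) : ConvexQuad b c d a :=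
  ⟨h.bcd, h.cda, h.dab, h.abc⟩

theorem ConvexPentagon.rotate {a b c d e : Plane} (h : ConvexPentagon a b c d e) :
    ConvexPentagon b c d e a where
  eab := h.abc
  abc := h.bcd
  bcd := h.cde
  cde := h.dea
  dea := h.eab
  acd := h.bde
  bde := h.cea
  cea := h.dab
  dab := h.ebc
  ebc := h.acd

/-- The triangles abd and acd both have the side da. They show that e also lies beyond the side db
of bcd, and this triangle yields the last sign. -/
theorem ConvexQuad.pentagon_of_neg (hI : NoInteriorPoint P) (hG : GeneralPosition P)
    {a b c d e : Plane} (h : ConvexQuad a b c d) (ha : a ∈ P) (hb : b ∈ P) (hc : c ∈ P)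
    (hd : d ∈ P) (he : e ∈ P) (ea : e ≠ a) (eb : e ≠ b) (ec : e ≠ c) (ed : e ≠ d)
    (hneg : cr d a e < 0) : ConvexPentagon a b c d e := by
  obtain ⟨abc, bcd, cda, dab⟩ := h
  obtain ⟨h1, h2⟩ := hI.beyond_side hG ha hb hd he (by rwa [← cr_rotate] at dab) ea eb ed hneg
  obtain ⟨h3, h4⟩ := hI.beyond_side hG ha hc hd he (by rwa [cr_rotate] at cda) ea ec ed hneg
  obtain ⟨h5, h6⟩ := hI.beyond_side hG hb hc hd he bcd eb ec ed
    (by rw [cr_swap]; linarith)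
  exact ⟨by rwa [← cr_rotate], abc, bcd, h4, by rw [cr_swap_right]; linarith,
    by rwa [cr_rotate] at cda, h2, by rwa [cr_rotate], dab, by rwa [← cr_rotate]⟩

theorem ConvexQuad.exists_pentagon (hI : NoInteriorPoint P) (hG : GeneralPosition P)
    {a b c d e : Plane} (h : ConvexQuad a b c d) (ha : a ∈ P) (hb : b ∈ P) (hc : c ∈ P)
    (hd : d ∈ P) (he : e ∈ P) (ea : e ≠ a) (eb : e ≠ b) (ec : e ≠ c) (ed : e ≠ d) :
    ConvexPentagon a b c d e ∨ ConvexPentagon b c d a e ∨ ConvexPentagon c d a b e ∨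
      ConvexPentagon d a b c e := by
  by_cases h1 : cr d a e < 0
  · exact Or.inl (h.pentagon_of_neg hI hG ha hb hc hd he ea eb ec ed h1)
  by_cases h2 : cr a b e < 0
  · exact Or.inr (Or.inl (h.rotate.pentagon_of_neg hI hG hb hc hd ha he eb ec ed ea h2))
  by_cases h3 : cr b c e < 0
  · exact Or.inr (Or.inr (Or.inl
      (h.rotate.rotate.pentagon_of_neg hI hG hc hd ha hb he ec ed ea eb h3)))
  by_cases h4 : cr c d e < 0
  · exact Or.inr (Or.inr (Or.inr
      (h.rotate.rotate.rotate.pentagon_of_neg hI hG hd ha hb hc he ed ea eb ec h4)))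
  -- A point beyond no side lies in one of the two triangles cut off by the diagonal ac.
  exfalso
  obtain ⟨nab, nbc, nac⟩ := ne_of_cr_ne_zero h.abc.ne'
  obtain ⟨ncd, nda, nca⟩ := ne_of_cr_ne_zero h.cda.ne'
  have p1 := lt_of_le_of_ne (not_lt.1 h1) (hG d hd a ha e he nda ea.symm ed).symm
  have p2 := lt_of_le_of_ne (not_lt.1 h2) (hG a ha b hb e he nab eb.symm ea).symm
  have p3 := lt_of_le_of_ne (not_lt.1 h3) (hG b hb c hc e he nbc ec.symm eb).symm
  have p4 := lt_of_le_of_ne (not_lt.1 h4) (hG c hc d hd e he ncd ed.symm ec).symm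
  rcases lt_or_gt_of_ne (hG a ha c hc e he nac ec.symm ea) with h5 | h5
  · exact hI a ha b hb c hc e he p2 p3 (by rw [cr_swap]; linarith)
  · exact hI a ha c hc d hd e he h5 p4 p1

/-! ### Areas in a convex pentagon. -/

/-- Here eₖ is the ear at the k-th vertex and iₖ the triangle on that vertex and the opposite side.
The linear relations compute the area of a quadrilateral along both diagonals; the quadratic ones
are Grassmann-Plücker relations at each vertex. If e₃ ≠ e₄, these are the only two values, `l₁`
forces i₅ = e₃ and i₂ = e₄, and every remaining assignment contradicts a relation. -/
theorem adjacent_ears_eq {α β e₁ e₂ e₃ e₄ e₅ i₁ i₂ i₃ i₄ i₅ : ℝ}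
    (h : ∀ x ∈ [e₁, e₂, e₃, e₄, e₅, i₁, i₂, i₃, i₄, i₅], 0 < x ∧ (x = α ∨ x = β))
    (l₁ : e₃ + i₂ = e₄ + i₅) (l₂ : e₄ + i₃ = e₅ + i₁) (l₃ : e₅ + i₄ = e₁ + i₂)
    (l₄ : e₁ + i₅ = e₂ + i₃) (l₅ : e₂ + i₁ = e₃ + i₄)
    (q₁ : e₂ * e₅ + e₁ * i₁ = i₃ * i₄) (q₂ : e₃ * e₁ + e₂ * i₂ = i₄ * i₅)
    (q₃ : e₄ * e₂ + e₃ * i₃ = i₅ * i₁) (q₄ : e₅ * e₃ + e₄ * i₄ = i₁ * i₂)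
    (q₅ : e₁ * e₄ + e₅ * i₅ = i₂ * i₃) : e₃ = e₄ := by
  simp only [List.mem_cons, List.not_mem_nil, or_false, forall_eq_or_imp, forall_eq] at h
  obtain ⟨⟨-, h1⟩, ⟨-, h2⟩, ⟨p3, h3⟩, ⟨p4, h4⟩, ⟨-, h5⟩, ⟨-, k1⟩, ⟨-, k2⟩, ⟨-, k3⟩, ⟨-, k4⟩,
    ⟨-, k5⟩⟩ := h
  by_contra hne
  have swap : ∀ x, (x = α ∨ x = β) → x = e₃ ∨ x = e₄ := by
    intro x hx
    rcases h3 with rfl | rfl <;> rcases h4 with rfl | rfl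
    · exact absurd rfl hne
    · exact hx
    · exact hx.symm
    · exact absurd rfl hne
  have a5 : i₅ = e₃ := (swap _ k5).resolve_right fun e5 => by
    rcases swap _ k2 with e | e
    · exact hne (by linarith)
    · exact hne (by linarith)
  have a2 : i₂ = e₄ := by linarith
  subst a5 a2
  have := mul_pos p3 p4
  have := mul_pos p3 p3
  have := mul_pos p4 p4
  rcases swap _ k3 with rfl | rfl <;> rcases swap _ h5 with rfl | rfl <;>
  rcases swap _ k1 with rfl | rfl <;> first
  | exact hne (by linarith)
  | (rcases swap _ h1 with rfl | rfl <;> rcases swap _ h2 with rfl | rfl <;>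
     rcases swap _ k4 with rfl | rfl <;>
     exact hne (by linarith))

/-- All ears have area `x / 2` and all other triangles have area `y / 2`, with `y / x` the golden
ratio. -/
structure GoldenAreas (a b c d e : Plane) (x y : ℝ) : Prop where
  pos : 0 < x
  lt : x < y
  golden : y ^ 2 = x ^ 2 + x * y
  eab : cr e a b = x
  abc : cr a b c = x
  bcd : cr b c d = x
  cde : cr c d e = x
  dea : cr d e a = x
  acd : cr a c d = y
  bde : cr b d e = y
  cea : cr c e a = y
  dab : cr d a b = y
  ebc : cr e b c = y

theorem ConvexPentagon.cr_bcd_eq_cde (hT : Types P α σ β τ) {a b c d e : Plane}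
    (h : ConvexPentagon a b c d e)
    (ha : a ∈ P) (hb : b ∈ P) (hc : c ∈ P) (hd : d ∈ P) (he : e ∈ P) :
    cr b c d = cr c d e := by
  refine adjacent_ears_eq (α := α) (β := β) (e₁ := cr e a b) (e₂ := cr a b c) (e₃ := cr b c d)
    (e₄ := cr c d e) (e₅ := cr d e a) (i₁ := cr a c d) (i₂ := cr b d e) (i₃ := cr c e a)
    (i₄ := cr d a b) (i₅ := cr e b c) ?_ ?_ ?_ ?_ ?_ ?_ ?_ ?_ ?_ ?_ ?_
  · simp only [List.mem_cons, List.not_mem_nil, or_false, forall_eq_or_imp, forall_eq]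
    exact ⟨⟨h.eab, hT.cr_mem he ha hb h.eab⟩, ⟨h.abc, hT.cr_mem ha hb hc h.abc⟩,
      ⟨h.bcd, hT.cr_mem hb hc hd h.bcd⟩, ⟨h.cde, hT.cr_mem hc hd he h.cde⟩,
      ⟨h.dea, hT.cr_mem hd he ha h.dea⟩, ⟨h.acd, hT.cr_mem ha hc hd h.acd⟩,
      ⟨h.bde, hT.cr_mem hb hd he h.bde⟩, ⟨h.cea, hT.cr_mem hc he ha h.cea⟩,
      ⟨h.dab, hT.cr_mem hd ha hb h.dab⟩, ⟨h.ebc, hT.cr_mem he hb hc h.ebc⟩⟩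
  all_goals simp only [cr]; ring

theorem ConvexPentagon.goldenAreas (hT : Types P α σ β τ) {a b c d e : Plane}
    (h : ConvexPentagon a b c d e)
    (ha : a ∈ P) (hb : b ∈ P) (hc : c ∈ P) (hd : d ∈ P) (he : e ∈ P) :
    ∃ x y, GoldenAreas a b c d e x y := by
  have e1 := h.cr_bcd_eq_cde hT ha hb hc hd he
  have e2 := h.rotate.cr_bcd_eq_cde hT hb hc hd he ha
  have e3 := h.rotate.rotate.cr_bcd_eq_cde hT hc hd he ha hb
  have e4 := h.rotate.rotate.rotate.cr_bcd_eq_cde hT hd he ha hb hc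
  have l1 : cr b c d + cr b d e = cr c d e + cr e b c := by simp only [cr]; ring
  have l2 : cr c d e + cr c e a = cr d e a + cr a c d := by simp only [cr]; ring
  have l3 : cr d e a + cr d a b = cr e a b + cr b d e := by simp only [cr]; ring
  have l4 : cr e a b + cr e b c = cr a b c + cr c e a := by simp only [cr]; ring
  have q : cr a b c * cr d e a + cr e a b * cr a c d = cr c e a * cr d a b := by
    simp only [cr]; ring
  have i1 : cr c e a = cr a c d := by linarith
  have i2 : cr d a b = cr a c d := by linarith
  have j1 : cr a b c = cr e a b := by linarith
  have j2 : cr d e a = cr e a b := by linarith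
  -- With all ears equal to x and the other triangles equal to y, the Plücker relation at a reads x²
  -- + xy = y².
  rw [i1, i2, j1, j2] at q
  have g : cr a c d ^ 2 = cr e a b ^ 2 + cr e a b * cr a c d := by linarith
  have p1 := h.eab
  have p2 := h.acd
  refine ⟨cr e a b, cr a c d, p1, ?_, g, rfl, ?_, ?_, ?_, ?_, rfl, ?_, ?_, ?_, ?_⟩
  · nlinarith [mul_pos p1 p2]
  all_goals linarith

/-- A sixth point cannot be added to a convex pentagon. -/
theorem ConvexPentagon.eq_of_mem (hT : Types P α σ β τ) (hI : NoInteriorPoint P)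
    (hG : GeneralPosition P) {a b c d e f : Plane} (h : ConvexPentagon a b c d e)
    (ha : a ∈ P) (hb : b ∈ P) (hc : c ∈ P) (hd : d ∈ P) (he : e ∈ P) (hf : f ∈ P) :
    f = a ∨ f = b ∨ f = c ∨ f = d ∨ f = e := by
  by_contra! hne
  obtain ⟨fa, fb, fc, fd, fe⟩ := hne
  obtain ⟨x, y, g⟩ := h.goldenAreas hT ha hb hc hd he
  have quad : ConvexQuad a b c d := ⟨h.abc, h.bcd, by rw [← cr_rotate, ← cr_rotate]; exact h.acd,
    h.dab⟩
  have lt := g.lt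
  have dab := g.dab
  have bcd := g.bcd
  have abc := g.abc
  have acd := g.acd
  -- In the known pentagon abc and bcd are ears, while acd and dab are not. If f lies beyond da, its
  -- areas over ab and bc coincide with those of e. Beyond any other side, the new pentagon sorts
  -- these four triangles in a way that contradicts x < y.
  rcases quad.exists_pentagon hI hG ha hb hc hd hf fa fb fc fd with h' | h' | h' | h'
  · obtain ⟨x', y', g'⟩ := h'.goldenAreas hT ha hb hc hd hf
    apply fe
    apply eq_of_cr_eq (a := a) (b := b) (c := c) h.abc.ne'
    · rw [← cr_rotate a b f, ← cr_rotate b f a, ← cr_rotate a b e, ← cr_rotate b e a, g'.eab,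
        g.eab, ← g'.abc, ← g.abc]
    · rw [← cr_rotate b c f, ← cr_rotate c f b, ← cr_rotate b c e, ← cr_rotate c e b, g'.ebc,
        g.ebc, ← g'.acd, ← g.acd]
  · obtain ⟨x', y', g'⟩ := h'.goldenAreas hT hb hc hd ha hf
    have := g'.abc
    have k := g'.dab
    have := g'.lt
    linarith
  · obtain ⟨x', y', g'⟩ := h'.goldenAreas hT hc hd ha hb hf
    have := g'.lt
    have k1 := g'.abc
    have k2 := g'.bcd
    have k3 := g'.dab
    linarith
  · obtain ⟨x', y', g'⟩ := h'.goldenAreas hT hd ha hb hc hf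
    have := g'.abc
    have := g'.bcd
    linarith

/-! ### From golden areas to the regular pentagon. -/

theorem exists_polar (x y : ℝ) :
    ∃ θ, x = √(x ^ 2 + y ^ 2) * Real.cos θ ∧ y = √(x ^ 2 + y ^ 2) * Real.sin θ := by
  have h : ‖(⟨x, y⟩ : ℂ)‖ = √(x ^ 2 + y ^ 2) := by
    rw [Complex.norm_def, Complex.normSq_mk]; ring_nf
  refine ⟨Complex.arg ⟨x, y⟩, ?_, ?_⟩
  · rw [← h, Complex.norm_mul_cos_arg]
  · rw [← h, Complex.norm_mul_sin_arg]

theorem cos_two_pi_div_five : Real.cos (2 * Real.pi / 5) = (√5 - 1) / 4 := by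
  rw [show 2 * Real.pi / 5 = 2 * (Real.pi / 5) by ring, Real.cos_two_mul, Real.cos_pi_div_five]
  have := Real.sq_sqrt (show (0 : ℝ) ≤ 5 by norm_num)
  linear_combination this / 8

/-- Five points around `o`, each obtained from the previous one by a fifth of a turn. -/
theorem isRegularPolygon_five_of_recurrence {o p₀ p₁ p₂ p₃ p₄ : Plane} {C : ℝ}
    (hC : C = Real.cos (2 * Real.pi / 5)) (hP : (P : Set Plane) = {p₀, p₁, p₂, p₃, p₄})
    (hpos : 0 < cr o p₀ p₁) (hnorm : sq o p₁ = sq o p₀)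
    (hinner : (p₀ 0 - o 0) * (p₁ 0 - o 0) + (p₀ 1 - o 1) * (p₁ 1 - o 1) = C * sq o p₀)
    (h₂ : ∀ i, p₂ i - o i = 2 * C * (p₁ i - o i) - (p₀ i - o i))
    (h₃ : ∀ i, p₃ i - o i = 2 * C * (p₂ i - o i) - (p₁ i - o i))
    (h₄ : ∀ i, p₄ i - o i = 2 * C * (p₃ i - o i) - (p₂ i - o i)) : IsRegularPolygon 5 P := by
  set S := Real.sin (2 * Real.pi / 5) with hS
  have hSpos : 0 < S := Real.sin_pos_of_pos_of_lt_pi (by positivity) (by linarith [Real.pi_pos])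
  have hR := sq_pos (ne_of_cr_ne_zero hpos.ne').1
  have hSC : S ^ 2 = 1 - C ^ 2 := by rw [hS, hC, Real.sin_sq]
  -- Lagrange's identity gives this up to sign; the orientation `hpos` fixes the sign.
  have hcr : cr o p₀ p₁ = S * sq o p₀ := by
    have : cr o p₀ p₁ ^ 2 = (S * sq o p₀) ^ 2 := by
      have id : cr o p₀ p₁ ^ 2 = sq o p₀ * sq o p₁ -
          ((p₀ 0 - o 0) * (p₁ 0 - o 0) + (p₀ 1 - o 1) * (p₁ 1 - o 1)) ^ 2 := by
        simp only [cr, sq]; ring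
      rw [id, hinner, hnorm, mul_pow S, hSC]; ring
    exact (pow_left_inj₀ hpos.le (by positivity) two_ne_zero).1 this
  obtain ⟨θ, hx, hy⟩ := exists_polar (p₀ 0 - o 0) (p₀ 1 - o 1)
  have hsq : (p₀ 0 - o 0) ^ 2 + (p₀ 1 - o 1) ^ 2 = sq o p₀ := by simp only [sq]; ring
  rw [hsq] at hx hy
  set r := √(sq o p₀) with hr
  have x1 : p₁ 0 - o 0 = r * Real.cos (θ + 2 * Real.pi / 5) := by
    rw [Real.cos_add, ← hC, ← hS, mul_sub, ← mul_assoc, ← mul_assoc, ← hx, ← hy]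
    apply mul_left_cancel₀ hR.ne'
    simp only [cr, sq] at *
    linear_combination (p₀ 0 - o 0) * hinner - (p₀ 1 - o 1) * hcr
  have y1 : p₁ 1 - o 1 = r * Real.sin (θ + 2 * Real.pi / 5) := by
    rw [Real.sin_add, ← hC, ← hS, mul_add, ← mul_assoc, ← mul_assoc, ← hx, ← hy]
    apply mul_left_cancel₀ hR.ne'
    simp only [cr, sq] at *
    linear_combination (p₀ 1 - o 1) * hinner + (p₀ 0 - o 0) * hcr
  -- Cosine and sine in steps of 2π/5 obey the same two-term recurrence as the points, so the polar
  -- form of p₀ and p₁ propagates to the others.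
  have rec_cos : ∀ φ, Real.cos (φ + 2 * Real.pi / 5 + 2 * Real.pi / 5) =
      2 * C * Real.cos (φ + 2 * Real.pi / 5) - Real.cos φ := by
    intro φ
    have : Real.cos φ = Real.cos (φ + 2 * Real.pi / 5 - 2 * Real.pi / 5) := by ring_nf
    rw [this, Real.cos_add (φ + 2 * Real.pi / 5), Real.cos_sub, hC]; ring
  have rec_sin : ∀ φ, Real.sin (φ + 2 * Real.pi / 5 + 2 * Real.pi / 5) =
      2 * C * Real.sin (φ + 2 * Real.pi / 5) - Real.sin φ := by
    intro φ
    have : Real.sin φ = Real.sin (φ + 2 * Real.pi / 5 - 2 * Real.pi / 5) := by ring_nf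
    rw [this, Real.sin_add (φ + 2 * Real.pi / 5), Real.sin_sub, hC]; ring
  have x2 := h₂ 0
  have y2 := h₂ 1
  rw [x1, hx, show ∀ u v w : ℝ, 2 * C * (u * v) - u * w = u * (2 * C * v - w) by intros; ring,
    ← rec_cos] at x2
  rw [y1, hy, show ∀ u v w : ℝ, 2 * C * (u * v) - u * w = u * (2 * C * v - w) by intros; ring,
    ← rec_sin] at y2
  have x3 := h₃ 0
  have y3 := h₃ 1
  rw [x2, x1, show ∀ u v w : ℝ, 2 * C * (u * v) - u * w = u * (2 * C * v - w) by intros; ring,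
    ← rec_cos] at x3
  rw [y2, y1, show ∀ u v w : ℝ, 2 * C * (u * v) - u * w = u * (2 * C * v - w) by intros; ring,
    ← rec_sin] at y3
  have x4 := h₄ 0
  have y4 := h₄ 1
  rw [x3, x2, show ∀ u v w : ℝ, 2 * C * (u * v) - u * w = u * (2 * C * v - w) by intros; ring,
    ← rec_cos] at x4
  rw [y3, y2, show ∀ u v w : ℝ, 2 * C * (u * v) - u * w = u * (2 * C * v - w) by intros; ring,
    ← rec_sin] at y4
  have vertex : ∀ (p : Plane) (φ ψ : ℝ), φ = ψ → p 0 - o 0 = r * Real.cos φ →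
      p 1 - o 1 = r * Real.sin φ → o + r • !₂[Real.cos ψ, Real.sin ψ] = p := by
    rintro p φ _ rfl h0 h1
    apply plane_ext
    · simp [← h0]
    · simp [← h1]
  refine ⟨by norm_num, o, r, θ, Real.sqrt_pos.2 hR, ?_⟩
  rw [hP]
  have e0 := vertex p₀ θ (θ + 2 * Real.pi * ((0 : Fin 5) : ℕ) / (5 : ℕ)) (by simp) hx hy
  have e1 := vertex p₁ _ (θ + 2 * Real.pi * ((1 : Fin 5) : ℕ) / (5 : ℕ)) (by simp) x1 y1
  have e2 := vertex p₂ _ (θ + 2 * Real.pi * ((2 : Fin 5) : ℕ) / (5 : ℕ)) (by simp; ring) x2 y2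
  have e3 := vertex p₃ _ (θ + 2 * Real.pi * ((3 : Fin 5) : ℕ) / (5 : ℕ)) (by simp; ring) x3 y3
  have e4 := vertex p₄ _ (θ + 2 * Real.pi * ((4 : Fin 5) : ℕ) / (5 : ℕ)) (by simp; ring) x4 y4
  rw [← e0, ← e1, ← e2, ← e3, ← e4]
  ext q
  simp only [Set.mem_insert_iff, Set.mem_singleton_iff, Set.mem_range]
  constructor
  · rintro (rfl | rfl | rfl | rfl | rfl)
    exacts [⟨0, rfl⟩, ⟨1, rfl⟩, ⟨2, rfl⟩, ⟨3, rfl⟩, ⟨4, rfl⟩]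
  · rintro ⟨k, rfl⟩
    fin_cases k
    exacts [Or.inl rfl, Or.inr (Or.inl rfl), Or.inr (Or.inr (Or.inl rfl)),
      Or.inr (Or.inr (Or.inr (Or.inl rfl))), Or.inr (Or.inr (Or.inr (Or.inr rfl)))]

set_option maxHeartbeats 800000 in
-- The areas give the coordinates of c and d in the affine frame a, b, e, with k the golden ratio.
-- The two side-sum equations then determine the shape of that frame.
theorem GoldenAreas.isRegularPolygon {a b c d e : Plane} {x y : ℝ} (g : GoldenAreas a b c d e x y)
    (hP : (P : Set Plane) = {a, b, c, d, e}) (h1 : sideSum e a b = sideSum a b c)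
    (h2 : sideSum d e a = sideSum a b c) : IsRegularPolygon 5 P := by
  obtain ⟨hx, hlt, hg, eab, abc, -, -, dea, -, -, cea, dab, -⟩ := g
  obtain ⟨k, rfl⟩ : ∃ k, y = k * x := ⟨y / x, by field_simp⟩
  have hk : k ^ 2 = k + 1 := by
    apply mul_left_cancel₀ (pow_pos hx 2).ne'
    linear_combination hg
  have hk1 : 1 < k := by nlinarith
  have hk5 : k = (1 + √5) / 2 := by
    have h5 := Real.sq_sqrt (show (0 : ℝ) ≤ 5 by norm_num)
    have h5' := Real.sqrt_nonneg 5
    have : (2 * k - 1) ^ 2 = √5 ^ 2 := by rw [h5]; linear_combination 4 * hk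
    have := (pow_left_inj₀ (by linarith) h5' two_ne_zero).1 this
    linarith
  have c0 : c 0 = a 0 + k * (b 0 - a 0) + (e 0 - a 0) := by
    apply mul_left_cancel₀ hx.ne'
    simp only [cr] at eab abc cea
    linear_combination (b 0 - a 0) * cea + (e 0 - a 0) * abc - (c 0 - a 0) * eab
  have c1 : c 1 = a 1 + k * (b 1 - a 1) + (e 1 - a 1) := by
    apply mul_left_cancel₀ hx.ne'
    simp only [cr] at eab abc cea
    linear_combination (b 1 - a 1) * cea + (e 1 - a 1) * abc - (c 1 - a 1) * eab
  have d0 : d 0 = a 0 + (b 0 - a 0) + k * (e 0 - a 0) := by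
    apply mul_left_cancel₀ hx.ne'
    simp only [cr] at eab dab dea
    linear_combination (b 0 - a 0) * dea + (e 0 - a 0) * dab - (d 0 - a 0) * eab
  have d1 : d 1 = a 1 + (b 1 - a 1) + k * (e 1 - a 1) := by
    apply mul_left_cancel₀ hx.ne'
    simp only [cr] at eab dab dea
    linear_combination (b 1 - a 1) * dea + (e 1 - a 1) * dab - (d 1 - a 1) * eab
  set U := sq a b with hU
  set V := sq a e with hV
  set W := (b 0 - a 0) * (e 0 - a 0) + (b 1 - a 1) * (e 1 - a 1) with hW
  have s0 : sideSum e a b = 2 * U + 2 * V - 2 * W := by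
    simp only [sideSum, sq, hU, hV, hW]; ring
  have s1 : sideSum a b c = U + ((k - 1) ^ 2 + k ^ 2) * U + 2 * V + 2 * (2 * k - 1) * W := by
    simp only [sideSum, sq, hU, hV, hW, c0, c1]; ring
  have s2 : sideSum d e a = V + ((k - 1) ^ 2 + k ^ 2) * V + 2 * U + 2 * (2 * k - 1) * W := by
    simp only [sideSum, sq, hU, hV, hW, d0, d1]; ring
  rw [s0, s1] at h1
  rw [s1, s2] at h2
  have hUV : V = U := by linear_combination h2 / 2 - (V - U) * hk
  -- The interior angle at a has cosine -(k - 1)/2 = cos 108°.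
  have hWU : W = -(k - 1) * U / 2 := by
    rw [hUV] at h1
    linear_combination (k - 1) * (-1 / 4) * h1 + (-k * U / 2 - W + U / 2) * hk
  -- The factor t = 1/(3 - k) is forced by the first recurrence: relative to the center a + t((b -
  -- a) + (e - a)), the vertices must satisfy c + a = (k - 1)b.
  obtain ⟨t, ht⟩ : ∃ t, t * (3 - k) = 1 := ⟨(2 + k) / 5, by linear_combination -hk / 5⟩
  have htpos : 0 < t := by
    have : k < 3 := by nlinarith
    by_contra hle
    nlinarith
  obtain ⟨o, o0, o1⟩ : ∃ o : Plane, o 0 = a 0 + t * ((b 0 - a 0) + (e 0 - a 0)) ∧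
      o 1 = a 1 + t * ((b 1 - a 1) + (e 1 - a 1)) :=
    ⟨!₂[a 0 + t * ((b 0 - a 0) + (e 0 - a 0)), a 1 + t * ((b 1 - a 1) + (e 1 - a 1))],
      by simp, by simp⟩
  refine isRegularPolygon_five_of_recurrence (o := o) (C := (k - 1) / 2) ?_ hP ?_ ?_ ?_ ?_ ?_ ?_
  · rw [cos_two_pi_div_five, hk5]; ring
  · have : cr o a b = t * cr e a b := by simp only [cr, o0, o1]; ring
    rw [this, eab]; positivity
  · have : sq o b - sq o a = U - 2 * t * (U + W) := by
      simp only [sq, o0, o1, hU, hW]; ring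
    rw [hWU] at this
    linear_combination this - U * ht
  · have h3 : (a 0 - o 0) * (b 0 - o 0) + (a 1 - o 1) * (b 1 - o 1) =
        -t * (U + W) + t ^ 2 * (U + V + 2 * W) := by
      simp only [sq, o0, o1, hU, hV, hW]; ring
    have h4 : sq o a = t ^ 2 * (U + V + 2 * W) := by
      simp only [sq, o0, o1, hU, hV, hW]; ring
    rw [h3, h4, hUV, hWU]
    linear_combination (t * U * (3 - k) / 2) * ht
  · intro i
    fin_cases i
    · simp only [Fin.zero_eta, c0, o0]
      linear_combination (-((b 0 - a 0) + (e 0 - a 0))) * ht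
    · simp only [Fin.mk_one, c1, o1]
      linear_combination (-((b 1 - a 1) + (e 1 - a 1))) * ht
  · intro i
    fin_cases i
    · simp only [Fin.zero_eta, c0, d0, o0]
      linear_combination (-((b 0 - a 0) + (e 0 - a 0))) * ht - (b 0 - a 0) * hk
    · simp only [Fin.mk_one, c1, d1, o1]
      linear_combination (-((b 1 - a 1) + (e 1 - a 1))) * ht - (b 1 - a 1) * hk
  · intro i
    fin_cases i
    · simp only [Fin.zero_eta, c0, d0, o0]
      linear_combination (-((b 0 - a 0) + (e 0 - a 0))) * ht - (e 0 - a 0) * hk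
    · simp only [Fin.mk_one, c1, d1, o1]
      linear_combination (-((b 1 - a 1) + (e 1 - a 1))) * ht - (e 1 - a 1) * hk

/-! ### Classification of sets with at most two triangles. -/

theorem exists_cr_ne_zero (hne : ∃ a ∈ P, ∃ b ∈ P, ∃ c ∈ P, 0 < cr a b c) {a b : Plane}
    (hab : a ≠ b) : ∃ d ∈ P, cr a b d ≠ 0 := by
  obtain ⟨p, hp, q, hq, r, hr, hpqr⟩ := hne
  by_contra! hall
  have hs := (sq_pos hab).ne'
  have h1 := hall p hp
  have h2 := hall q hq
  have h3 := hall r hr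
  apply hpqr.ne'
  apply mul_left_cancel₀ hs
  simp only [cr, sq] at *
  linear_combination ((b 0 - a 0) * (r 0 - q 0) + (b 1 - a 1) * (r 1 - q 1)) * h1 +
    ((b 0 - a 0) * (p 0 - r 0) + (b 1 - a 1) * (p 1 - r 1)) * h2 +
    ((b 0 - a 0) * (q 0 - p 0) + (b 1 - a 1) * (q 1 - p 1)) * h3

/-- The classification of the sets of at least five points with at most two triangles. -/
theorem Types.classification (hT : Types P α σ β τ) (hcard : 5 ≤ P.card)
    (hne : ∃ a ∈ P, ∃ b ∈ P, ∃ c ∈ P, 0 < cr a b c) :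
    IsSquareWithCenter P ∨ IsRegularPolygon 5 P := by
  by_cases hG : GeneralPosition P
  · right
    have hI := hT.noInteriorPoint hG hcard
    obtain ⟨a, ha, b, hb, c, hc, d, hd, hQ⟩ := hI.exists_convexQuad hG (by omega)
    obtain ⟨e, he, hel⟩ := exists_mem_not_mem_of_card [a, b, c, d]
      (lt_of_lt_of_le (by simp) hcard)
    simp only [List.mem_cons, List.not_mem_nil, or_false, not_or] at hel
    obtain ⟨ea, eb, ec, ed⟩ := hel
    have fin : ∀ a ∈ P, ∀ b ∈ P, ∀ c ∈ P, ∀ d ∈ P, ConvexPentagon a b c d e →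
        IsRegularPolygon 5 P := by
      intro a ha b hb c hc d hd h
      obtain ⟨x, y, g⟩ := h.goldenAreas hT ha hb hc hd he
      -- Ears and other triangles have different areas, so both types occur and equal areas give
      -- equal side sums.
      have hαβ : α ≠ β := by
        intro hαβ
        have h1 := hT.cr_mem ha hb hc h.abc
        have h2 := hT.cr_mem ha hc hd h.acd
        rw [g.abc, hαβ, or_self] at h1
        rw [g.acd, hαβ, or_self] at h2
        exact g.lt.ne (h1.trans h2.symm)
      refine g.isRegularPolygon ?_
        (hT.sideSum_eq hαβ he ha hb ha hb hc h.eab (g.eab.trans g.abc.symm))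
        (hT.sideSum_eq hαβ hd he ha ha hb hc h.dea (g.dea.trans g.abc.symm))
      ext f
      simp only [Finset.mem_coe, Set.mem_insert_iff, Set.mem_singleton_iff]
      constructor
      · exact h.eq_of_mem hT hI hG ha hb hc hd he
      · rintro (rfl | rfl | rfl | rfl | rfl) <;> assumption
    rcases hQ.exists_pentagon hI hG ha hb hc hd he ea eb ec ed with h | h | h | h
    · exact fin a ha b hb c hc d hd h
    · exact fin b hb c hc d hd a ha h
    · exact fin c hc d hd a ha b hb h
    · exact fin d hd a ha b hb c hc h
  · left
    simp only [GeneralPosition, not_forall, not_not] at hG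
    obtain ⟨a, ha, b, hb, c, hc, hab, hbc, hca, h0⟩ := hG
    obtain ⟨d, hd, h⟩ := exists_cr_ne_zero hne hab
    exact hT.isSquareWithCenter_of_collinear hcard ha hb hc hd hbc hca h0 h

/-! ### The extremal configurations determine the stated number of triangles. -/

theorem heron (a b c : Plane) : 4 * cr a b c ^ 2 =
    4 * (sq a b * sq b c) - (sq a b + sq b c - sq c a) ^ 2 := by
  simp only [cr, sq]; ring

/-- `SameSides` for labels of the sides. -/
def SameLabels {m : ℕ} (x y z p q r : Fin m) : Prop :=
  (x = p ∧ y = q ∧ z = r) ∨ (x = p ∧ y = r ∧ z = q) ∨ (x = q ∧ y = p ∧ z = r) ∨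
  (x = q ∧ y = r ∧ z = p) ∨ (x = r ∧ y = p ∧ z = q) ∨ (x = r ∧ y = q ∧ z = p)

instance {m : ℕ} (x y z p q r : Fin m) : Decidable (SameLabels x y z p q r) := by
  unfold SameLabels; infer_instance

theorem SameLabels.sameSides {m : ℕ} {x y z p q r : Fin m} (h : SameLabels x y z p q r)
    (v : Fin m → ℝ) : SameSides (v x) (v y) (v z) (v p) (v q) (v r) := by
  rcases h with ⟨rfl, rfl, rfl⟩ | ⟨rfl, rfl, rfl⟩ | ⟨rfl, rfl, rfl⟩ | ⟨rfl, rfl, rfl⟩ |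
    ⟨rfl, rfl, rfl⟩ | ⟨rfl, rfl, rfl⟩ <;> simp [SameSides]

theorem cr_eq_zero_of_eq {a b c : Plane} (h : a = b ∨ b = c ∨ c = a) : cr a b c = 0 := by
  rcases h with rfl | rfl | rfl <;> simp only [cr] <;> ring

theorem IsRectangle.numTriangles_eq_one {P : Finset Plane} (h : IsRectangle P) :
    numTriangles P = 1 := by
  obtain ⟨A, B, C, D, ⟨hAB, hAD, hBC, hin⟩, hP⟩ := h
  have i0 := congrArg (fun v : Plane => v 0) hBC
  have i1 := congrArg (fun v : Plane => v 1) hBC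
  simp only [PiLp.sub_apply] at i0 i1
  have hin' : (B 0 - A 0) * (D 0 - A 0) + (B 1 - A 1) * (D 1 - A 1) = 0 := by
    rw [← hin]; simp [PiLp.inner_apply, Fin.sum_univ_two]; ring
  have c0 : C 0 = B 0 + D 0 - A 0 := by linarith
  have c1 : C 1 = B 1 + D 1 - A 1 := by linarith
  let V : Fin 4 → Plane := ![A, B, C, D]
  -- `κ` labels the distance between two vertices and `v` evaluates the labels, so that comparing
  -- all triples becomes a finite check. Labels 1 and 2 are the sides, 3 is the diagonal.
  let κ : Fin 4 → Fin 4 → Fin 4 :=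
    ![![0, 1, 3, 2], ![1, 0, 2, 3], ![3, 2, 0, 1], ![2, 3, 1, 0]]
  let v : Fin 4 → ℝ := ![0, sq A B, sq A D, sq A B + sq A D]
  have hmem : ∀ x, x ∈ P ↔ ∃ i, V i = x := by
    intro x
    rw [← Finset.mem_coe, hP]
    simp [V, Fin.exists_fin_succ, eq_comm]
  have hκ : ∀ i j, sq (V i) (V j) = v (κ i j) := by
    intro i j
    fin_cases i <;> fin_cases j <;> simp [V, κ, v, sq, c0, c1] <;> linarith
  have hlab : ∀ i j k : Fin 4, i = j ∨ j = k ∨ k = i ∨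
      SameLabels (κ i j) (κ j k) (κ k i) 1 2 3 := by
    simp only [κ]; decide
  have hpos : cr A B C ≠ 0 := by
    have e : cr A B C ^ 2 = sq A B * sq A D := by
      simp only [cr, sq, c0, c1]
      linear_combination (-((B 0 - A 0) * (D 0 - A 0) + (B 1 - A 1) * (D 1 - A 1))) * hin'
    intro h0
    rw [h0] at e
    have := mul_pos (sq_pos hAB) (sq_pos hAD)
    linarith
  refine FewTriangles.numTriangles_eq_one ((hmem A).2 ⟨0, rfl⟩) ((hmem B).2 ⟨1, rfl⟩) ((hmem C).2 ⟨2, rfl⟩)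
    hpos ?_
  intro x hx y hy z hz hcr
  obtain ⟨i, rfl⟩ := (hmem x).1 hx
  obtain ⟨j, rfl⟩ := (hmem y).1 hy
  obtain ⟨k, rfl⟩ := (hmem z).1 hz
  have t1 : sq A B = v 1 := hκ 0 1
  have t2 : sq B C = v 2 := hκ 1 2
  have t3 : sq C A = v 3 := hκ 2 0
  rw [hκ, hκ, hκ, t1, t2, t3]
  rcases hlab i j k with h | h | h | hl
  · exact absurd (cr_eq_zero_of_eq (by rw [h]; simp)) hcr
  · exact absurd (cr_eq_zero_of_eq (by rw [h]; simp)) hcr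
  · exact absurd (cr_eq_zero_of_eq (by rw [h]; simp)) hcr
  · exact hl.sameSides v

theorem IsSquareWithCenter.numTriangles_eq_two {P : Finset Plane} (h : IsSquareWithCenter P) :
    numTriangles P = 2 := by
  obtain ⟨A, B, C, D, ⟨⟨hAB, hAD, hBC, hin⟩, hd⟩, hP⟩ := h
  have i0 := congrArg (fun v : Plane => v 0) hBC
  have i1 := congrArg (fun v : Plane => v 1) hBC
  simp only [PiLp.sub_apply] at i0 i1
  have hin' : (B 0 - A 0) * (D 0 - A 0) + (B 1 - A 1) * (D 1 - A 1) = 0 := by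
    rw [← hin]; simp [PiLp.inner_apply, Fin.sum_univ_two]; ring
  have c0 : C 0 = B 0 + D 0 - A 0 := by linarith
  have c1 : C 1 = B 1 + D 1 - A 1 := by linarith
  have hs : sq A B = sq A D := by rw [sq_eq_dist_sq, sq_eq_dist_sq, hd]
  obtain ⟨M, hM⟩ : ∃ M, M = midpoint ℝ A C := ⟨_, rfl⟩
  have m0 : M 0 = (B 0 + D 0) / 2 := by
    rw [hM]; simp [midpoint_eq_smul_add, c0]; ring
  have m1 : M 1 = (B 1 + D 1) / 2 := by
    rw [hM]; simp [midpoint_eq_smul_add, c1]; ring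
  rw [← hM] at hP
  let V : Fin 5 → Plane := ![A, B, C, D, M]
  -- Labels: 1 for a side, 2 for a diagonal, 3 for half a diagonal.
  let κ : Fin 5 → Fin 5 → Fin 4 :=
    ![![0, 1, 2, 1, 3], ![1, 0, 1, 2, 3], ![2, 1, 0, 1, 3], ![1, 2, 1, 0, 3], ![3, 3, 3, 3, 0]]
  let v : Fin 4 → ℝ := ![0, sq A B, 2 * sq A B, sq A B / 2]
  have hmem : ∀ x, x ∈ P ↔ ∃ i, V i = x := by
    intro x
    rw [← Finset.mem_coe, hP]
    simp [V, Fin.exists_fin_succ, eq_comm]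
  have hs' := hs
  simp only [sq] at hs'
  have hκ : ∀ i j, sq (V i) (V j) = v (κ i j) := by
    intro i j
    fin_cases i <;> fin_cases j <;> simp [V, κ, v, sq, c0, c1, m0, m1] <;> linarith
  -- The pattern 3, 3, 2 is the degenerate one, two opposite vertices with the center; it is
  -- discarded below by Heron's formula.
  have hlab : ∀ i j k : Fin 5, i = j ∨ j = k ∨ k = i ∨
      SameLabels (κ i j) (κ j k) (κ k i) 3 3 2 ∨
      SameLabels (κ i j) (κ j k) (κ k i) 1 1 2 ∨
      SameLabels (κ i j) (κ j k) (κ k i) 3 3 1 := by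
    simp only [κ]; decide
  have hp := sq_pos hAB
  have t1 : sq A B = v 1 := hκ 0 1
  have t2 : sq B C = v 1 := hκ 1 2
  have t3 : sq C A = v 2 := hκ 2 0
  have s1 : sq A M = v 3 := hκ 0 4
  have s2 : sq M B = v 3 := hκ 4 1
  have s3 : sq B A = v 1 := hκ 1 0
  have v1 : v 1 = sq A B := rfl
  have v2 : v 2 = 2 * sq A B := rfl
  have v3 : v 3 = sq A B / 2 := rfl
  have hpos : cr A B C ≠ 0 := by
    have e := heron A B C
    rw [t2, t3, v1, v2] at e
    intro h0
    rw [h0] at e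
    nlinarith
  have hpos' : cr A M B ≠ 0 := by
    have e := heron A M B
    rw [s1, s2, s3, v1, v3] at e
    intro h0
    rw [h0] at e
    nlinarith
  have hA : A ∈ P := (hmem A).2 ⟨0, rfl⟩
  have hB : B ∈ P := (hmem B).2 ⟨1, rfl⟩
  have hC : C ∈ P := (hmem C).2 ⟨2, rfl⟩
  have hM' : M ∈ P := (hmem M).2 ⟨4, rfl⟩
  clear_value V κ v
  refine FewTriangles.numTriangles_eq_two hA hB hC hA hM' hB hpos hpos' ?_ ?_
  · simp only [sideSum]
    rw [t2, t3, s1, s2, s3, v1, v2, v3]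
    intro h; linarith
  intro x hx y hy z hz hcr
  obtain ⟨i, rfl⟩ := (hmem x).1 hx
  obtain ⟨j, rfl⟩ := (hmem y).1 hy
  obtain ⟨k, rfl⟩ := (hmem z).1 hz
  have hh := heron (V i) (V j) (V k)
  rw [hκ, hκ, hκ] at hh
  rw [hκ, hκ, hκ, s1, s2, s3, t1, t2, t3]
  rcases hlab i j k with h | h | h | hl | hl | hl
  · exact absurd (cr_eq_zero_of_eq (by rw [h]; simp)) hcr
  · exact absurd (cr_eq_zero_of_eq (by rw [h]; simp)) hcr
  · exact absurd (cr_eq_zero_of_eq (by rw [h]; simp)) hcr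
  · exfalso
    apply hcr
    rcases hl with ⟨e1, e2, e3⟩ | ⟨e1, e2, e3⟩ | ⟨e1, e2, e3⟩ | ⟨e1, e2, e3⟩ | ⟨e1, e2, e3⟩ |
      ⟨e1, e2, e3⟩ <;> rw [e1, e2, e3, v3, v2] at hh <;>
    exact (pow_eq_zero_iff two_ne_zero).1 (by linarith)
  · exact Or.inl (hl.sameSides v)
  · exact Or.inr (hl.sameSides v)

theorem IsRegularPolygon.numTriangles_eq_two {P : Finset Plane} (h : IsRegularPolygon 5 P) :
    numTriangles P = 2 := by
  obtain ⟨-, o, r, θ, hr, hP⟩ := h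
  set V : Fin 5 → Plane := fun k => o + r • !₂[Real.cos (θ + 2 * Real.pi * (k : ℕ) / (5 : ℕ)),
        Real.sin (θ + 2 * Real.pi * (k : ℕ) / (5 : ℕ))] with hV
  -- Labels: 1 for a side, 2 for a diagonal of the pentagon.
  let κ : Fin 5 → Fin 5 → Fin 3 :=
    ![![0, 1, 2, 2, 1], ![1, 0, 1, 2, 2], ![2, 1, 0, 1, 2], ![2, 2, 1, 0, 1], ![1, 2, 2, 1, 0]]
  let v : Fin 3 → ℝ := ![0, r ^ 2 * ((5 - √5) / 2), r ^ 2 * ((5 + √5) / 2)]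
  have hmem : ∀ x, x ∈ P ↔ ∃ i, V i = x := by
    intro x
    rw [← Finset.mem_coe, hP]; rfl
  have h5 := Real.sq_sqrt (show (0 : ℝ) ≤ 5 by norm_num)
  have C1 := cos_two_pi_div_five
  have C2 : Real.cos (4 * Real.pi / 5) = -(√5 + 1) / 4 := by
    rw [show 4 * Real.pi / 5 = 2 * (2 * Real.pi / 5) by ring, Real.cos_two_mul, C1]
    linear_combination h5 / 8
  have C3 : Real.cos (6 * Real.pi / 5) = -(√5 + 1) / 4 := by
    rw [show 6 * Real.pi / 5 = 2 * Real.pi - 4 * Real.pi / 5 by ring, Real.cos_two_pi_sub, C2]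
  have C4 : Real.cos (8 * Real.pi / 5) = (√5 - 1) / 4 := by
    rw [show 8 * Real.pi / 5 = 2 * Real.pi - 2 * Real.pi / 5 by ring, Real.cos_two_pi_sub, C1]
  have hsq : ∀ i j, sq (V i) (V j) =
      2 * r ^ 2 * (1 - Real.cos (2 * Real.pi * ((i : ℕ) - (j : ℕ) : ℝ) / 5)) := by
    intro i j
    have e : 2 * Real.pi * ((i : ℕ) - (j : ℕ) : ℝ) / 5 =
      (θ + 2 * Real.pi * (i : ℕ) / (5 : ℕ)) - (θ + 2 * Real.pi * (j : ℕ) / (5 : ℕ)) := by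
      push_cast; ring
    rw [e, Real.cos_sub]
    simp only [sq, hV, PiLp.add_apply, PiLp.smul_apply, smul_eq_mul, Matrix.cons_val_zero,
      Matrix.cons_val_one]
    linear_combination r ^ 2 * Real.sin_sq_add_cos_sq (θ + 2 * Real.pi * (i : ℕ) / (5 : ℕ)) +
      r ^ 2 * Real.sin_sq_add_cos_sq (θ + 2 * Real.pi * (j : ℕ) / (5 : ℕ))
  have hlow : ∀ i j, i ≤ j → sq (V i) (V j) = v (κ i j) := by
    intro i j hij
    rw [sq_comm, hsq]
    fin_cases i <;> fin_cases j <;> first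
    | exact absurd hij (by decide)
    | (norm_num [v, κ]; done)
    | (rw [show ∀ p q : ℝ, q - p = 1 → 2 * Real.pi * (q - p) / 5 = 2 * Real.pi / 5 by
          intro p q h; rw [h]; ring] <;> first
       | (norm_num; done)
       | (rw [C1]; simp [v, κ]; ring))
    | (rw [show ∀ p q : ℝ, q - p = 2 → 2 * Real.pi * (q - p) / 5 = 4 * Real.pi / 5 by
          intro p q h; rw [h]; ring] <;> first
       | (norm_num; done)
       | (rw [C2]; simp [v, κ]; ring))
    | (rw [show ∀ p q : ℝ, q - p = 3 → 2 * Real.pi * (q - p) / 5 = 6 * Real.pi / 5 by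
          intro p q h; rw [h]; ring] <;> first
       | (norm_num; done)
       | (rw [C3]; simp [v, κ]; ring))
    | (rw [show ∀ p q : ℝ, q - p = 4 → 2 * Real.pi * (q - p) / 5 = 8 * Real.pi / 5 by
          intro p q h; rw [h]; ring] <;> first
       | (norm_num; done)
       | (rw [C4]; simp [v, κ]; ring))
  have hsymm : ∀ i j, κ i j = κ j i := by simp only [κ]; decide
  have hκ : ∀ i j, sq (V i) (V j) = v (κ i j) := by
    intro i j
    rcases le_total i j with h | h
    · exact hlow i j h
    · rw [sq_comm, hlow j i h, hsymm]
  have hlab : ∀ i j k : Fin 5, i = j ∨ j = k ∨ k = i ∨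
      SameLabels (κ i j) (κ j k) (κ k i) 1 1 2 ∨
      SameLabels (κ i j) (κ j k) (κ k i) 2 1 2 := by
    simp only [κ]; decide
  have h5' : √5 < 3 := by rw [Real.sqrt_lt' (by norm_num)]; norm_num
  have h50 : 0 < √5 := by positivity
  have hr2 : 0 < r ^ 2 := by positivity
  have t1 : sq (V 0) (V 1) = v 1 := hκ 0 1
  have t2 : sq (V 1) (V 2) = v 1 := hκ 1 2
  have t3 : sq (V 2) (V 0) = v 2 := hκ 2 0
  have s1 : sq (V 0) (V 2) = v 2 := hκ 0 2
  have s2 : sq (V 2) (V 3) = v 1 := hκ 2 3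
  have s3 : sq (V 3) (V 0) = v 2 := hκ 3 0
  have v1 : v 1 = r ^ 2 * ((5 - √5) / 2) := rfl
  have v2 : v 2 = r ^ 2 * ((5 + √5) / 2) := rfl
  have hv1 : 0 < v 1 := by rw [v1]; apply mul_pos hr2; linarith
  have hv2 : 0 < v 2 := by rw [v2]; apply mul_pos hr2; linarith
  have hlt : v 1 < v 2 := by rw [v1, v2]; apply mul_lt_mul_of_pos_left _ hr2; linarith
  -- A diagonal is shorter than two sides, so the triangle with labels 1, 1, 2 is nondegenerate.
  have hlt' : v 2 < 4 * v 1 := by rw [v1, v2]; nlinarith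
  have hpos : cr (V 0) (V 1) (V 2) ≠ 0 := by
    have e := heron (V 0) (V 1) (V 2)
    rw [t1, t2, t3] at e
    intro h0
    rw [h0] at e
    nlinarith
  have hpos' : cr (V 0) (V 2) (V 3) ≠ 0 := by
    have e := heron (V 0) (V 2) (V 3)
    rw [s1, s2, s3] at e
    intro h0
    rw [h0] at e
    nlinarith
  refine FewTriangles.numTriangles_eq_two ((hmem _).2 ⟨0, rfl⟩) ((hmem _).2 ⟨1, rfl⟩)
    ((hmem _).2 ⟨2, rfl⟩) ((hmem _).2 ⟨0, rfl⟩) ((hmem _).2 ⟨2, rfl⟩) ((hmem _).2 ⟨3, rfl⟩)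
    hpos hpos' ?_ ?_
  · simp only [sideSum]
    rw [t1, t2, t3, s1, s2, s3]
    intro h; linarith
  intro x hx y hy z hz hcr
  obtain ⟨i, rfl⟩ := (hmem x).1 hx
  obtain ⟨j, rfl⟩ := (hmem y).1 hy
  obtain ⟨k, rfl⟩ := (hmem z).1 hz
  rw [hκ, hκ, hκ, s1, s2, s3, t1, t2, t3]
  rcases hlab i j k with h | h | h | hl | hl
  · exact absurd (cr_eq_zero_of_eq (by rw [h]; simp)) hcr
  · exact absurd (cr_eq_zero_of_eq (by rw [h]; simp)) hcr
  · exact absurd (cr_eq_zero_of_eq (by rw [h]; simp)) hcr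
  · exact Or.inl (hl.sameSides v)
  · exact Or.inr (hl.sameSides v)

/-! ### Sets with a single triangle. -/

/-- A collinear triple, an interior point or a convex pentagon would each produce two different
areas. A convex quadrilateral remains: equal areas of abc, bcd, dab make it a parallelogram, and
equal side sums of abc and dab make its diagonals equal. -/
theorem Types.isRectangle (hT : Types P α σ α σ) (hcard : 4 ≤ P.card)
    (hne : ∃ a ∈ P, ∃ b ∈ P, ∃ c ∈ P, 0 < cr a b c) : IsRectangle P := by
  have hG : GeneralPosition P := by
    intro a ha b hb c hc hab hbc hca h0
    obtain ⟨d, hd, h⟩ := exists_cr_ne_zero hne hab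
    have h0' : cr b c a = 0 := by rw [cr_rotate, h0]
    have h1 := cr_ne_zero_of_collinear h0 hbc h
    have h2 := cr_ne_zero_of_collinear h0' hca h1
    rcases hT.exists_midpoint ha hb hc hd h0 h h1 h2 with ⟨e, -⟩ | ⟨e, -⟩ | ⟨e, -⟩
    · exact (hT.of_between' ha hb hc hd h0 e).1 rfl
    · exact (hT.of_between' hb hc ha hd h0' e).1 rfl
    · exact (hT.of_between' hc ha hb hd (by rw [cr_rotate, h0']) e).1 rfl
  have hI : NoInteriorPoint P := by
    intro a ha b hb c hc d hd h1 h2 h3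
    have hsum := cr_add a b c d
    have m := hT.cr_mem ha hb hc (by linarith)
    rw [← hsum] at m
    exact (eq_of_add_add_mem_pair h1 h2 h3 (hT.cr_mem ha hb hd h1) (hT.cr_mem hb hc hd h2)
      (hT.cr_mem hc ha hd h3) m).2.2 rfl
  obtain ⟨a, ha, b, hb, c, hc, d, hd, hQ⟩ := hI.exists_convexQuad hG hcard
  have no_pentagon : ∀ e ∈ P, ∀ a ∈ P, ∀ b ∈ P, ∀ c ∈ P, ∀ d ∈ P, ¬ ConvexPentagon a b c d e := by
    intro e he a ha b hb c hc d hd h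
    obtain ⟨x, y, g⟩ := h.goldenAreas hT ha hb hc hd he
    have h1 := or_self_iff.1 (hT.cr_mem ha hb hc h.abc)
    have h2 := or_self_iff.1 (hT.cr_mem ha hc hd h.acd)
    rw [g.abc] at h1
    rw [g.acd] at h2
    exact g.lt.ne (h1.trans h2.symm)
  have k1 := or_self_iff.1 (hT a ha b hb c hc hQ.abc)
  have k2 := or_self_iff.1 (hT b hb c hc d hd hQ.bcd)
  have k4 := or_self_iff.1 (hT d hd a ha b hb hQ.dab)
  have e1 : cr a b c = cr d a b := k1.1.trans k4.1.symm
  have e2 : cr a b c = cr b c d := k1.1.trans k2.1.symm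
  have i0 : b 0 - a 0 = c 0 - d 0 := by
    apply mul_left_cancel₀ hQ.abc.ne'
    simp only [cr] at e1 e2 ⊢
    linear_combination (b 0 - a 0) * e2 - (c 0 - b 0) * e1
  have i1 : b 1 - a 1 = c 1 - d 1 := by
    apply mul_left_cancel₀ hQ.abc.ne'
    simp only [cr] at e1 e2 ⊢
    linear_combination (b 1 - a 1) * e2 - (c 1 - b 1) * e1
  have hS : sideSum a b c = sideSum d a b := k1.2.trans k4.2.symm
  have c0 : c 0 = b 0 - a 0 + d 0 := by linarith
  have c1 : c 1 = b 1 - a 1 + d 1 := by linarith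
  refine ⟨a, b, c, d, ⟨(ne_of_cr_ne_zero hQ.abc.ne').1, (ne_of_cr_ne_zero hQ.dab.ne').1.symm,
    plane_ext i0 i1, ?_⟩, ?_⟩
  · rw [inner_sub_sub]
    simp only [sideSum, sq, c0, c1] at hS
    linarith
  · ext e
    simp only [Finset.mem_coe, Set.mem_insert_iff, Set.mem_singleton_iff]
    constructor
    · intro he
      by_contra! hne
      obtain ⟨ea, eb, ec, ed⟩ := hne
      rcases hQ.exists_pentagon hI hG ha hb hc hd he ea eb ec ed with h | h | h | h
      · exact no_pentagon e he a ha b hb c hc d hd h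
      · exact no_pentagon e he b hb c hc d hd a ha h
      · exact no_pentagon e he c hc d hd a ha b hb h
      · exact no_pentagon e he d hd a ha b hb c hc h
    · rintro (rfl | rfl | rfl | rfl) <;> assumption

/-! ### Size bounds, examples and the final assembly. -/

theorem IsRectangle.card_le (h : IsRectangle P) : P.card ≤ 4 := by
  classical
  obtain ⟨A, B, C, D, -, hP⟩ := h
  have : P = {A, B, C, D} := by rw [← Finset.coe_inj, hP]; simp
  rw [this]; exact Finset.card_le_four

theorem IsSquareWithCenter.card_le (h : IsSquareWithCenter P) : P.card ≤ 5 := by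
  classical
  obtain ⟨A, B, C, D, -, hP⟩ := h
  have : P = {A, B, C, D, midpoint ℝ A C} := by rw [← Finset.coe_inj, hP]; simp
  rw [this]; exact Finset.card_le_five

theorem IsRegularPolygon.card_le {n : ℕ} (h : IsRegularPolygon n P) : P.card ≤ n := by
  classical
  obtain ⟨-, c, r, θ, -, hP⟩ := h
  rw [← Set.ncard_coe_finset, hP, ← Set.image_univ]
  refine (Set.ncard_image_le Set.finite_univ).trans ?_
  simp [Set.ncard_univ]

theorem isRectangle_of_numTriangles_eq_one (h : numTriangles P = 1) (hcard : 4 ≤ P.card) :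
    IsRectangle P := by
  obtain ⟨α, σ, hT⟩ := exists_types_of_numTriangles_eq_one h
  exact hT.isRectangle hcard (exists_cr_pos_of_numTriangles_ne_zero (by omega))

theorem classification_of_numTriangles_eq_two (h : numTriangles P = 2) (hcard : 5 ≤ P.card) :
    IsSquareWithCenter P ∨ IsRegularPolygon 5 P := by
  obtain ⟨α, σ, β, τ, hT⟩ := exists_types_of_numTriangles_eq_two h
  exact hT.classification hcard (exists_cr_pos_of_numTriangles_ne_zero (by omega))

theorem squareVertices_unit :
    SquareVertices !₂[(0 : ℝ), 0] !₂[(1 : ℝ), 0] !₂[(1 : ℝ), 1] !₂[(0 : ℝ), 1] := by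
  refine ⟨⟨fun h => ?_, fun h => ?_, ?_, ?_⟩, ?_⟩
  · simpa using congrArg (fun v : Plane => v 0) h
  · simpa using congrArg (fun v : Plane => v 1) h
  · apply plane_ext <;> simp
  · rw [inner_sub_sub]; simp
  · apply dist_eq_of_sq_eq; simp [sq]

theorem mk_eq_mk_iff {x y x' y' : ℝ} :
    (!₂[x, y] : Plane) = !₂[x', y'] ↔ x = x' ∧ y = y' := by
  refine ⟨fun he => ⟨?_, ?_⟩, fun ⟨h, h'⟩ => by rw [h, h']⟩
  · simpa using congrArg (fun v : Plane => v 0) he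
  · simpa using congrArg (fun v : Plane => v 1) he

end FewTriangles

theorem theorem1 :
    (IsGreatest (FewTriangles.sizesDetermining 1) 4 ∧
      ∀ P : Finset FewTriangles.Plane, P.card = 4 →
        (FewTriangles.numTriangles P = 1 ↔ FewTriangles.IsRectangle P)) ∧
    (IsGreatest (FewTriangles.sizesDetermining 2) 5 ∧
      ∀ P : Finset FewTriangles.Plane, P.card = 5 →
        (FewTriangles.numTriangles P = 2 ↔
          FewTriangles.IsSquareWithCenter P ∨ FewTriangles.IsRegularPolygon 5 P)) := by
  classical
  refine ⟨⟨⟨?_, ?_⟩, fun P hP => ⟨fun h => ?_, fun h => h.numTriangles_eq_one⟩⟩,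
    ⟨⟨?_, ?_⟩, fun P hP => ⟨fun h => ?_, fun h => ?_⟩⟩⟩
  · refine ⟨{!₂[(0 : ℝ), 0], !₂[(1 : ℝ), 0], !₂[(1 : ℝ), 1], !₂[(0 : ℝ), 1]}, ?_, ?_⟩
    · rw [Finset.card_insert_of_notMem, Finset.card_insert_of_notMem,
        Finset.card_insert_of_notMem,
        Finset.card_singleton] <;> norm_num [FewTriangles.mk_eq_mk_iff]
    · refine FewTriangles.IsRectangle.numTriangles_eq_one
        ⟨_, _, _, _, FewTriangles.squareVertices_unit.1, by simp⟩
  · rintro n ⟨P, rfl, h⟩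
    by_contra! hlt
    have := (FewTriangles.isRectangle_of_numTriangles_eq_one h hlt.le).card_le
    omega
  · exact FewTriangles.isRectangle_of_numTriangles_eq_one h hP.ge
  · have hm : midpoint ℝ (!₂[(0 : ℝ), 0] : FewTriangles.Plane) !₂[(1 : ℝ), 1] =
        !₂[(1 / 2 : ℝ), 1 / 2] := by
      apply FewTriangles.plane_ext <;> simp [midpoint_eq_smul_add]
    refine ⟨{!₂[(0 : ℝ), 0], !₂[(1 : ℝ), 0], !₂[(1 : ℝ), 1], !₂[(0 : ℝ), 1],
      !₂[(1 / 2 : ℝ), 1 / 2]}, ?_, ?_⟩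
    · rw [Finset.card_insert_of_notMem, Finset.card_insert_of_notMem,
        Finset.card_insert_of_notMem, Finset.card_insert_of_notMem,
        Finset.card_singleton] <;> norm_num [FewTriangles.mk_eq_mk_iff]
    · refine FewTriangles.IsSquareWithCenter.numTriangles_eq_two
        ⟨_, _, _, _, FewTriangles.squareVertices_unit, ?_⟩
      rw [hm]; simp
  · rintro n ⟨P, rfl, h⟩
    by_contra! hlt
    rcases FewTriangles.classification_of_numTriangles_eq_two h hlt.le with h | h
    · have := h.card_le; omega
    · have := h.card_le; omega
  · exact FewTriangles.classification_of_numTriangles_eq_two h hP.ge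
  · rcases h with h | h
    · exact h.numTriangles_eq_two
    · exact h.numTriangles_eq_two
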